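/- Let $\alpha\in(0,1)$ and $c>0$. Let $G=(V,E)$ be a finite simple undirected graph with $n$ nodes, $m$ edges and no isolated node, given by adjacency lists $N(u)$ ($u\in V$), let $d_u=|N(u)|$, and let $t\in V$. The PageRank vector $\pi\in\mathbb{R}^V$ is the unique solution of $\pi=(1-\alpha)AD^{-1}\pi+\frac{\alpha}{n}\mathbf 1$, where $A$ is the adjacency matrix and $D=\mathrm{diag}(d_u)$. Put $$L=\log_{1-\alpha}\frac{c\alpha}{2n},\qquad \theta=\max\left\{\frac{\alpha c^2}{12L\,d_t},\ \frac{\alpha c^2}{12L}\sqrt{\frac{2(1-\alpha)}{m}}\right\},$$ and assume $c\alpha<2n$, so that $L>0$ (this is automatic if $c\le 1$). The algorithm SetPush does the following. It starts from the vectors $r^{(0)}=e_t$ and $\hat\pi_t=\alpha e_t$. For each integer $\ell$ with $0\le\ell\le L-1$ (that is, $\lfloor L\rfloor$ times) it sets $r^{(\ell+1)}=0$ and processes each $u\in V$ with $r^{(\ell)}(u)\neq 0$ as follows. * If $(1-\alpha)r^{(\ell)}(u)\ge\theta d_u$, it adds $\frac{1-\alpha}{d_u}r^{(\ell)}(u)$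 to $r^{(\ell+1)}(v)$ for every $v\in N(u)$. * Otherwise it sets $p^*=\frac{(1-\alpha)r^{(\ell)}(u)}{d_u\theta}$ and $idx=0$, and repeats: draw a fresh independent geometric number $rg\in\{1,2,\dots\}$ (the number of Bernoulli trials up to the first success) with success probability $p^*$; increase $idx$ by $rg$; if $idx>d_u$, stop; else add $\theta$ to $r^{(\ell+1)}(v)$, where $v$ is the $idx$-th entry of $N(u)$. It then adds $\alpha r^{(\ell+1)}$ to $\hat\pi_t$. At the end it returns $\hat\pi(t)=\frac1n\sum_{s\in V}\frac{d_t}{d_s}\hat\pi_t(s)$. Running time is measured in two ways: by the number $\mathrm{Cost}$ of residue updates (additions to some entry $r^{(\ell+1)}(v)$); and by the number $T$ of all elementary steps, where vectors are stored sparsely and one step is charged for each residue update, each geometric draw, each node processed, and each nonzero entry touched when $r^{(\ell)}$ is cleared, when $\alpha r^{(\ell+1)}$ is added to $\hat\pi_t$, and when the final sum is formed, with two further steps per iteration of the main loop and four for initialization and return. **Theorem.** In this setting the following hold. 1. $\Pr\big[\,|\hat\pi(t)-\pi(t)|\le c\,\pi(t)\,\big]\ge \tfrac23$. 2. The expected cost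 satisfies $$\mathbb E[\mathrm{Cost}]\le B:=\frac{12L}{\alpha^2c^2}\cdot\min\left\{d_t,\sqrt{\frac{m}{2(1-\alpha)}}\right\},\qquad \mathbb E[T]\le 8\,(1+L+B).$$ 3. Both are $\tilde O(\min\{d_t,\sqrt m\})$ for constant $\alpha$ and $c$: there is a constant $C>0$ depending only on $\alpha$ and $c$ such that, for all such $G$ and $t$, $B\le C\log n\cdot\min\{d_t,\sqrt m\}$ and $\mathbb E[T]\le C\log n\cdot\min\{d_t,\sqrt m\}$. 4. $\dfrac{n\,\pi(t)}{d_t}\ge\alpha\sqrt{\dfrac{2(1-\alpha)}{m}}$ for every node $t$. -/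

import Mathlib

open scoped ENNReal

noncomputable section

namespace SetPush

/-! ### PageRank on undirected graphs -/

section PageRank

variable {V : Type*} [Fintype V] [DecidableEq V] (G : SimpleGraph V) [DecidableRel G.Adj]

/-- The transition matrix `A D⁻¹`, with `A` the adjacency matrix and `D` the diagonal degree
matrix. -/
def transition : Matrix V V ℝ :=
  G.adjMatrix ℝ * Matrix.diagonal (fun u => (G.degree u : ℝ)⁻¹)

/-- The defining equation `π = (1 - α) A D⁻¹ π + (α / n) 1` of the PageRank vector. -/
def IsPageRank (α : ℝ) (x : V → ℝ) : Prop :=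
  x = (1 - α) • (transition G).mulVec x + fun _ => α / (Fintype.card V : ℝ)

/-- The PageRank vector `(I - (1 - α) A D⁻¹)⁻¹ (α / n) 1` with damping factor `α`. -/
def pageRank (α : ℝ) : V → ℝ :=
  ((1 : Matrix V V ℝ) - (1 - α) • transition G)⁻¹.mulVec (fun _ => α / (Fintype.card V : ℝ))

/-- On a graph without isolated vertices, `pageRank` is the one solution of the defining
equation. -/
theorem isPageRank_iff {α : ℝ} (hα₀ : 0 < α) (hα₁ : α < 1) (hdeg : ∀ u, 0 < G.degree u)
    (x : V → ℝ) : IsPageRank G α x ↔ x = pageRank G α := by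
  have happ : ∀ i k, transition G i k = if G.Adj i k then (G.degree k : ℝ)⁻¹ else 0 := by
    intro i k
    simp [transition, Matrix.mul_diagonal, SimpleGraph.adjMatrix_apply]
  have hcol : ∀ k, ∑ i, transition G i k = 1 := by
    intro k
    have h0 : (G.degree k : ℝ) ≠ 0 := by exact_mod_cast (hdeg k).ne'
    have h1 : ∑ i, transition G i k = ∑ i ∈ G.neighborFinset k, (G.degree k : ℝ)⁻¹ := by
      rw [← Finset.sum_filter_add_sum_filter_not Finset.univ (fun i => G.Adj k i)]
      have : G.neighborFinset k = Finset.univ.filter (fun i => G.Adj k i) := by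
        ext i; simp
      rw [this]
      have e1 : ∑ i ∈ Finset.univ.filter (fun i => G.Adj k i), transition G i k
          = ∑ i ∈ Finset.univ.filter (fun i => G.Adj k i), (G.degree k : ℝ)⁻¹ := by
        refine Finset.sum_congr rfl fun i hi => ?_
        rw [happ, if_pos (Finset.mem_filter.mp hi).2.symm]
      have e2 : ∑ i ∈ Finset.univ.filter (fun i => ¬ G.Adj k i), transition G i k = 0 := by
        refine Finset.sum_eq_zero fun i hi => ?_
        rw [happ, if_neg (fun h => (Finset.mem_filter.mp hi).2 h.symm)]
      rw [e1, e2, add_zero]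
    rw [h1, Finset.sum_const, SimpleGraph.card_neighborFinset_eq_degree, nsmul_eq_mul,
      mul_inv_cancel₀ h0]
  set M : Matrix V V ℝ := 1 - (1 - α) • transition G with hM
  have hdet : M.det ≠ 0 := by
    refine det_ne_zero_of_sum_col_lt_diag fun k => ?_
    have hkk : M k k = 1 := by simp [hM, happ]
    have hoff : ∀ i ∈ Finset.univ.erase k, ‖M i k‖ = (1 - α) * transition G i k := by
      intro i hi
      have hne : i ≠ k := Finset.ne_of_mem_erase hi
      have hnn : 0 ≤ (1 - α) * transition G i k := by
        refine mul_nonneg (by linarith) ?_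
        rw [happ]; split_ifs <;> positivity
      rw [hM]
      simp only [Matrix.sub_apply, Matrix.smul_apply, smul_eq_mul, Matrix.one_apply_ne hne,
        zero_sub, norm_neg, Real.norm_eq_abs]
      exact abs_of_nonneg hnn
    rw [Finset.sum_congr rfl hoff, ← Finset.mul_sum, hkk, norm_one]
    have : ∑ i ∈ Finset.univ.erase k, transition G i k = 1 := by
      have h2 := Finset.add_sum_erase Finset.univ (fun i => transition G i k) (Finset.mem_univ k)
      rw [hcol k] at h2
      simpa [happ] using h2
    rw [this]; linarith
  have hu : IsUnit M.det := isUnit_iff_ne_zero.mpr hdet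
  have hmul : ∀ y : V → ℝ, M.mulVec y = y - (1 - α) • (transition G).mulVec y := by
    intro y
    rw [hM, Matrix.sub_mulVec, Matrix.one_mulVec, Matrix.smul_mulVec]
  constructor
  · intro h
    have h' : M.mulVec x = fun _ => α / (Fintype.card V : ℝ) := by
      rw [hmul, sub_eq_iff_eq_add']; exact h
    rw [pageRank, ← hM, ← h', Matrix.mulVec_mulVec, Matrix.nonsing_inv_mul _ hu,
      Matrix.one_mulVec]
  · rintro rfl
    have h' : M.mulVec (pageRank G α) = fun _ => α / (Fintype.card V : ℝ) := by
      rw [pageRank, ← hM, Matrix.mulVec_mulVec, Matrix.mul_nonsing_inv _ hu, Matrix.one_mulVec]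
    rw [hmul, sub_eq_iff_eq_add'] at h'
    exact h'

end PageRank

/-! ### Parameters -/

/-- The truncation length `log_{1 - α} (c α / (2 n))`, a real number. -/
def truncLength (α c : ℝ) (n : ℕ) : ℝ :=
  Real.logb (1 - α) (c * α / (2 * n))

/-- The threshold `max {α c² / (12 L d), (α c² / (12 L)) √(2 (1 - α) / m)}`, where `L` is the
truncation length, `d` the degree of the target and `m` the number of edges. -/
def threshold (α c : ℝ) (n m d : ℕ) : ℝ :=
  max (α * c ^ 2 / (12 * truncLength α c n * d))
    (α * c ^ 2 / (12 * truncLength α c n) * Real.sqrt (2 * (1 - α) / m))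

/-! ### The algorithm, as a randomized program with counters -/

/-- `N` stores the graph `G`: `N u` lists each neighbour of `u` once, in some order. -/
def IsAdjacencyLists {V : Type*} (G : SimpleGraph V) (N : V → List V) : Prop :=
  ∀ u, (N u).Nodup ∧ ∀ v, v ∈ N u ↔ G.Adj u v

/-- The number of Bernoulli trials with success probability `p` up to and including the first
success. (Mathlib's `geometricMeasure` counts the failures only.) -/
def geometricTrials (p : unitInterval) : PMF ℕ :=
  (ProbabilityTheory.geometricMeasure p).toPMF.map (fun k => k + 1)

section Algorithm

variable {V : Type*} [Fintype V] [DecidableEq V]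

/-- The memory of the program in iteration `ℓ`, and two counters. -/
@[ext]
structure State (V : Type*) where
  /-- the residues `r^(ℓ)` -/
  res : V → ℝ
  /-- the residues `r^(ℓ+1)` under construction -/
  next : V → ℝ
  /-- the accumulated vector `α ∑ r^(i)` -/
  acc : V → ℝ
  /-- the number of residue updates `r^(ℓ+1)(v) ← r^(ℓ+1)(v) + x` made so far -/
  pushes : ℕ
  /-- the number of elementary steps made so far, residue updates included -/
  steps : ℕ

/-- The nonzero entries of a vector. Vectors are stored sparsely. -/
def nonzeros (x : V → ℝ) : Finset V := Finset.univ.filter (fun u => x u ≠ 0)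

/-- Spend `k` elementary steps. -/
def tick (k : ℕ) (s : State V) : State V := { s with steps := s.steps + k }

/-- The update `r^(ℓ+1)(v) ← r^(ℓ+1)(v) + x`. -/
def push (x : ℝ) (s : State V) (v : V) : State V :=
  { s with
    next := Function.update s.next v (s.next v + x)
    pushes := s.pushes + 1
    steps := s.steps + 1 }

/-- The `while` loop over the adjacency list `nbrs`: draw `rg`, add it to `idx`, leave the loop
if `idx` exceeds the length of the list, and otherwise increase the residue of the `idx`-th
neighbour (counted from one) by `θ`. Each draw is one elementary step. -/
def sampleLoop (nbrs : List V) (θ : ℝ) (p : unitInterval) (idx : ℕ) (s : State V) :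
    PMF (State V) :=
  (geometricTrials p).bind fun rg =>
    if h : 0 < rg ∧ idx + rg ≤ nbrs.length then
      sampleLoop nbrs θ p (idx + rg) (push θ (tick 1 s) (nbrs[idx + rg - 1]'(by omega)))
    else PMF.pure (tick 1 s)
termination_by nbrs.length - idx
decreasing_by omega

/-- The push operation at the node `u`; reading `r^(ℓ)(u)` and comparing is one elementary
step. In the sampling branch `p*` lies strictly between `0` and `1`, so that projecting it to the
unit interval does nothing. -/
def processNode (N : V → List V) (α θ : ℝ) (u : V) (s : State V) : PMF (State V) :=
  let d : ℝ := (N u).length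
  if θ * d ≤ (1 - α) * s.res u then
    PMF.pure ((N u).foldl (push ((1 - α) / d * s.res u)) (tick 1 s))
  else
    sampleLoop (N u) θ (Set.projIcc 0 1 zero_le_one ((1 - α) * s.res u / (d * θ))) 0 (tick 1 s)

/-- `for each u in the list, processNode u`. -/
def processNodes (N : V → List V) (α θ : ℝ) : List V → State V → PMF (State V)
  | [], s => PMF.pure s
  | u :: us, s => (processNode N α θ u s).bind (processNodes N α θ us)

/-- The end of an iteration: clear `r^(ℓ)`, add `α r^(ℓ+1)` to the accumulated vector and make
`r^(ℓ+1)` the current residue vector. The cost is one step for each nonzero entry touched. -/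
def finishRound (α : ℝ) (s : State V) : State V :=
  { s with
    res := s.next
    acc := s.acc + α • s.next
    steps := s.steps + (nonzeros s.res).card + (nonzeros s.next).card }

/-- One iteration of the main loop; its control and the initialization `r^(ℓ+1) ← 0` are two
elementary steps. -/
def round (N : V → List V) (α θ : ℝ) (s : State V) : PMF (State V) :=
  (processNodes N α θ (nonzeros s.res).toList { tick 2 s with next := 0 }).map (finishRound α)

/-- The given number of iterations of the main loop. -/
def rounds (N : V → List V) (α θ : ℝ) : ℕ → State V → PMF (State V)
  | 0, s => PMF.pure s
  | k + 1, s => (round N α θ s).bind (rounds N α θ k)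

/-- What a run of the program leaves behind: the estimate that it returns, and the counters. -/
structure Output where
  /-- the returned estimate -/
  estimate : ℝ
  /-- the number of residue updates -/
  pushes : ℕ
  /-- the number of all elementary steps -/
  steps : ℕ

/-- The initial state: `r^(0) = e_t`, and the accumulated vector is `α e_t`. With the computation
of the number of iterations these are three elementary steps. -/
def initState (α : ℝ) (t : V) : State V where
  res := Pi.single t 1
  next := 0
  acc := Pi.single t α
  pushes := 0
  steps := 3

/-- Return `(1 / n) ∑_s (d_t / d_s) π̂_t(s)`; one step for each nonzero entry, and one to
return. -/
def output (N : V → List V) (t : V) (s : State V) : Output where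
  estimate := 1 / (Fintype.card V : ℝ) *
    ∑ v, ((N t).length : ℝ) / ((N v).length : ℝ) * s.acc v
  pushes := s.pushes
  steps := s.steps + (nonzeros s.acc).card + 1

/-- The algorithm SetPush on the graph stored in `N`, with damping factor `α`, relative error
`c`, threshold `θ` and target `t`. The main loop runs over the integers `0 ≤ ℓ ≤ L - 1`, where `L`
is the truncation length. -/
def setPush (N : V → List V) (α c θ : ℝ) (t : V) : PMF Output :=
  (rounds N α θ ⌊truncLength α c (Fintype.card V)⌋₊ (initState α t)).map (output N t)

end Algorithm

/-! ### Guarantees -/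

/-- The random estimate `X` is a `(c, p)`-approximation of `x`: with probability at least `1 - p`
it satisfies `|X - x| ≤ c x`. -/
def IsApproximation (X : PMF ℝ) (c p x : ℝ) : Prop :=
  ENNReal.ofReal (1 - p) ≤ X.toOuterMeasure {y | |y - x| ≤ c * x}

/-- The expected value, possibly infinite, of a counter. -/
def expectedCount {Ω : Type*} (P : PMF Ω) (f : Ω → ℕ) : ℝ≥0∞ := ∑' ω, P ω * (f ω : ℝ≥0∞)

end SetPush

end

/-!
Write `P` for the operator `x ↦ (1 - α) A D⁻¹ x` (`flow`) and `P'` for its transpose (`pull`). One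
iteration of SetPush turns the residues `r` into random residues of expected value `P r`: by the
memorylessness of the geometric distribution (`sampleLoop_apply`), skipping ahead by geometric
numbers is the same as pushing `θ` to each neighbour independently with probability `p*`. Hence a
linear functional `∑ h r` has, after an iteration, the mean `∑ (P' h) r` and a variance of at most
`θ ∑ (P' h²) r`, and the expected number of updates is at most `(1 - α) ∑ r / θ`
(`isRound_round`).

The graph is undirected, so `z = d_t π / d` solves `z = P' z + α β` with `β = d_t / (n d)`, and the
estimate is `∑ β acc`. With the potentials `g_0 = 0` and `g_{j+1} = P' (α β + g_j)`, the quantity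
`∑ β acc + ∑ g_j r`, where `j` iterations are left, is a martingale. The potentials increase
geometrically to `z - α β` (`potential_bounds`), and `z ≤ d_t / n ≤ 1` by a maximum principle. So

* the mean of the estimate misses `π(t)` by at most `(1 - α)^(⌊L⌋ + 1) ≤ c α / (2 n) ≤ c π(t) / 2`,
* each iteration adds at most `θ (d_t / n) π(t)` to the variance
  (`mean_sq_dotProduct_acc_rounds_le`), in total at most `c² π(t)² / 12`.

The last bound uses the two lower bounds `n π(t) ≥ α` and `n π(t) / d_t ≥ α √(2 (1 - α) / m)`, which
match the two terms of the threshold. The second one comes from the walks of length at most one,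
the Cauchy–Schwarz inequality and the inequality of arithmetic and geometric means
(`sqrt_le_pageRank_div_degree`). Chebyshev's inequality then gives the approximation.

The total residue shrinks by the factor `1 - α` per iteration in expectation, so the expected number
of updates is at most `1 / (α θ)`, which is the explicit bound on the cost. All other steps are
charged to the updates and to the iterations (`steps_rounds_le`).
-/

open scoped ENNReal

noncomputable section

namespace SetPush

/-! ### Expectations of real random variables with finite support -/

section Mean

variable {Ω Ω' : Type*}

/-- The expected value of `f` under `P`. It is used for distributions of finite support only,
so that no summability question arises. -/
def mean (P : PMF Ω) (f : Ω → ℝ) : ℝ := ∑' ω, (P ω).toReal * f ω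

theorem apply_eq_zero_of_notMem_toFinset {P : PMF Ω} (hP : P.support.Finite) {ω : Ω}
    (hω : ω ∉ hP.toFinset) : P ω = 0 := by
  rw [PMF.apply_eq_zero_iff]; simpa using hω

theorem mean_eq_sum {P : PMF Ω} (hP : P.support.Finite) (f : Ω → ℝ) :
    mean P f = ∑ ω ∈ hP.toFinset, (P ω).toReal * f ω := by
  refine tsum_eq_sum fun ω hω => ?_
  simp [apply_eq_zero_of_notMem_toFinset hP hω]

theorem sum_toReal_support {P : PMF Ω} (hP : P.support.Finite) :
    ∑ ω ∈ hP.toFinset, (P ω).toReal = 1 := by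
  rw [← ENNReal.toReal_sum (fun ω _ => P.apply_ne_top ω), ← tsum_eq_sum (L := .unconditional _),
    P.tsum_coe, ENNReal.toReal_one]
  intro ω hω
  rw [PMF.apply_eq_zero_iff]; simpa using hω

theorem mean_pure (a : Ω) (f : Ω → ℝ) : mean (PMF.pure a) f = f a := by
  classical
  rw [mean, tsum_eq_single a]
  · simp
  · intro b hb; simp [PMF.pure_apply, hb]

theorem mean_const {P : PMF Ω} (hP : P.support.Finite) (a : ℝ) : mean P (fun _ => a) = a := by
  rw [mean_eq_sum hP, ← Finset.sum_mul, sum_toReal_support hP, one_mul]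

theorem mean_add {P : PMF Ω} (hP : P.support.Finite) (f g : Ω → ℝ) :
    mean P (fun ω => f ω + g ω) = mean P f + mean P g := by
  simp only [mean_eq_sum hP, mul_add, Finset.sum_add_distrib]

theorem mean_const_mul {P : PMF Ω} (hP : P.support.Finite) (a : ℝ) (f : Ω → ℝ) :
    mean P (fun ω => a * f ω) = a * mean P f := by
  simp only [mean_eq_sum hP, Finset.mul_sum]
  exact Finset.sum_congr rfl fun _ _ => by ring

theorem mean_mono {P : PMF Ω} (hP : P.support.Finite) {f g : Ω → ℝ}
    (h : ∀ ω ∈ P.support, f ω ≤ g ω) : mean P f ≤ mean P g := by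
  simp only [mean_eq_sum hP]
  exact Finset.sum_le_sum fun ω hω =>
    mul_le_mul_of_nonneg_left (h ω (by simpa using hω)) ENNReal.toReal_nonneg

theorem mean_congr {P : PMF Ω} (hP : P.support.Finite) {f g : Ω → ℝ}
    (h : ∀ ω ∈ P.support, f ω = g ω) : mean P f = mean P g :=
  le_antisymm (mean_mono hP fun ω hω => (h ω hω).le) (mean_mono hP fun ω hω => (h ω hω).ge)

theorem finite_support_bind {P : PMF Ω} (hP : P.support.Finite) {Q : Ω → PMF Ω'}
    (hQ : ∀ ω ∈ P.support, (Q ω).support.Finite) : (P.bind Q).support.Finite := by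
  rw [PMF.support_bind]
  exact hP.biUnion hQ

theorem mean_bind {P : PMF Ω} (hP : P.support.Finite) {Q : Ω → PMF Ω'}
    (hQ : ∀ ω ∈ P.support, (Q ω).support.Finite) (f : Ω' → ℝ) :
    mean (P.bind Q) f = mean P fun ω => mean (Q ω) f := by
  classical
  have hB := finite_support_bind hP hQ
  have hval : ∀ b, ((P.bind Q) b).toReal = ∑ ω ∈ hP.toFinset, (P ω).toReal * (Q ω b).toReal := by
    intro b
    rw [PMF.bind_apply, tsum_eq_sum (s := hP.toFinset), ENNReal.toReal_sum]
    · simp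
    · exact fun ω _ => ENNReal.mul_ne_top (P.apply_ne_top ω) ((Q ω).apply_ne_top b)
    · intro ω hω
      simp [apply_eq_zero_of_notMem_toFinset hP hω]
  rw [mean_eq_sum hB, mean_eq_sum hP]
  simp only [hval, Finset.sum_mul]
  rw [Finset.sum_comm]
  refine Finset.sum_congr rfl fun ω hω => ?_
  have hω' : ω ∈ P.support := by simpa using hω
  rw [mean_eq_sum (hQ ω hω'), Finset.mul_sum]
  refine (Finset.sum_subset ?_ ?_).symm.trans (Finset.sum_congr rfl fun b _ => by ring)
  · intro b hb
    rw [Set.Finite.mem_toFinset, PMF.mem_support_bind_iff]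
    exact ⟨ω, hω', by simpa using hb⟩
  · intro b _ hb
    simp [apply_eq_zero_of_notMem_toFinset (hQ ω hω') hb]

theorem finite_support_map {P : PMF Ω} (hP : P.support.Finite) (g : Ω → Ω') :
    (P.map g).support.Finite := by
  rw [PMF.support_map]; exact hP.image g

theorem mean_map {P : PMF Ω} (hP : P.support.Finite) (g : Ω → Ω') (f : Ω' → ℝ) :
    mean (P.map g) f = mean P fun ω => f (g ω) := by
  rw [← PMF.bind_pure_comp, mean_bind hP (fun ω _ => by simp)]
  simp only [Function.comp_apply, mean_pure]

/-- A mixture of two finitely supported distributions is finitely supported. -/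
theorem finite_support_of_mixture {P Q R : PMF Ω} {a b : ℝ≥0∞}
    (h : ∀ ω, P ω = a * Q ω + b * R ω) (hQ : Q.support.Finite) (hR : R.support.Finite) :
    P.support.Finite := by
  refine (hQ.union hR).subset fun ω hω => ?_
  by_contra hn
  simp only [Set.mem_union, PMF.mem_support_iff, not_or, not_not] at hn
  exact hω (by rw [h, hn.1, hn.2]; simp)

theorem mean_of_mixture {P Q R : PMF Ω} {a b : ℝ} (ha : 0 ≤ a) (hb : 0 ≤ b)
    (h : ∀ ω, P ω = ENNReal.ofReal a * Q ω + ENNReal.ofReal b * R ω)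
    (hQ : Q.support.Finite) (hR : R.support.Finite) (f : Ω → ℝ) :
    mean P f = a * mean Q f + b * mean R f := by
  have hsum : ∀ S : PMF Ω, S.support.Finite → Summable fun ω => (S ω).toReal * f ω := by
    intro S hS
    refine summable_of_ne_finset_zero (s := hS.toFinset) fun ω hω => ?_
    simp [apply_eq_zero_of_notMem_toFinset hS hω]
  rw [mean, mean, mean, ← tsum_mul_left, ← tsum_mul_left,
    ← ((hsum Q hQ).mul_left a).tsum_add ((hsum R hR).mul_left b)]
  refine tsum_congr fun ω => ?_
  rw [h, ENNReal.toReal_add (ENNReal.mul_ne_top ENNReal.ofReal_ne_top (Q.apply_ne_top ω))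
    (ENNReal.mul_ne_top ENNReal.ofReal_ne_top (R.apply_ne_top ω)), ENNReal.toReal_mul,
    ENNReal.toReal_mul, ENNReal.toReal_ofReal ha, ENNReal.toReal_ofReal hb]
  ring

theorem expectedCount_eq_ofReal_mean {P : PMF Ω} (hP : P.support.Finite) (f : Ω → ℕ) :
    expectedCount P f = ENNReal.ofReal (mean P fun ω => (f ω : ℝ)) := by
  rw [expectedCount, mean_eq_sum hP, ENNReal.ofReal_sum_of_nonneg (fun _ _ => by positivity),
    tsum_eq_sum (s := hP.toFinset)]
  · refine Finset.sum_congr rfl fun ω _ => ?_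
    rw [ENNReal.ofReal_mul ENNReal.toReal_nonneg, ENNReal.ofReal_toReal (P.apply_ne_top ω),
      ENNReal.ofReal_natCast]
  · intro ω hω
    simp [apply_eq_zero_of_notMem_toFinset hP hω]

/-- Chebyshev's inequality, with the second moment in place of the variance. -/
theorem chebyshev {P : PMF Ω} (hP : P.support.Finite) (X : Ω → ℝ) {a v ε : ℝ} (hε : 0 < ε)
    (hmean : mean P X = a) (hsq : mean P (fun ω => X ω ^ 2) ≤ a ^ 2 + v) :
    ENNReal.ofReal (1 - v / ε ^ 2) ≤ P.toOuterMeasure {ω | |X ω - a| ≤ ε} := by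
  classical
  have hvar : mean P (fun ω => (X ω - a) ^ 2) ≤ v := by
    have e : mean P (fun ω => (X ω - a) ^ 2)
        = mean P (fun ω => X ω ^ 2) + (-2 * a * mean P X + a ^ 2) := by
      rw [← mean_const_mul hP]
      conv_rhs => rw [← mean_const hP (a ^ 2)]
      rw [← mean_add hP, ← mean_add hP]
      refine mean_congr hP fun ω _ => ?_
      ring
    rw [e, hmean]; linarith
  have hind : 1 - v / ε ^ 2 ≤ mean P fun ω => if |X ω - a| ≤ ε then 1 else 0 := by
    have h1 : mean P (fun ω => 1 + (-1 / ε ^ 2) * (X ω - a) ^ 2)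
        ≤ mean P fun ω => if |X ω - a| ≤ ε then 1 else 0 := by
      refine mean_mono hP fun ω _ => ?_
      have hε2 : 0 < ε ^ 2 := by positivity
      have h0 : (-1 / ε ^ 2) * (X ω - a) ^ 2 = -((X ω - a) ^ 2 / ε ^ 2) := by ring
      rw [h0]
      split_ifs with h
      · have : 0 ≤ (X ω - a) ^ 2 / ε ^ 2 := by positivity
        linarith
      · have : 1 ≤ (X ω - a) ^ 2 / ε ^ 2 := by
          rw [le_div_iff₀ hε2, one_mul, ← sq_abs (X ω - a)]
          have := lt_of_not_ge h
          nlinarith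
        linarith
    rw [mean_add hP, mean_const hP, mean_const_mul hP] at h1
    refine le_trans ?_ h1
    have : mean P (fun ω => (X ω - a) ^ 2) / ε ^ 2 ≤ v / ε ^ 2 := by gcongr
    have h0 : (-1 / ε ^ 2) * mean P (fun ω => (X ω - a) ^ 2)
      = -(mean P (fun ω => (X ω - a) ^ 2) / ε ^ 2) := by ring
    rw [h0]; linarith
  refine (ENNReal.ofReal_le_ofReal hind).trans (le_of_eq ?_)
  rw [mean_eq_sum hP, ENNReal.ofReal_sum_of_nonneg
    (fun ω _ => mul_nonneg ENNReal.toReal_nonneg (by split_ifs <;> norm_num)),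
    PMF.toOuterMeasure_apply, tsum_eq_sum (s := hP.toFinset)]
  · refine Finset.sum_congr rfl fun ω _ => ?_
    by_cases h : |X ω - a| ≤ ε
    · simp [Set.indicator, h, ENNReal.ofReal_toReal (P.apply_ne_top ω)]
    · simp [Set.indicator, h]
  · intro ω hω
    simp [Set.indicator, apply_eq_zero_of_notMem_toFinset hP hω]

end Mean

/-! ### One step of the random walk on vectors -/

section Operators

variable {V : Type*}

/-- The transposed operator `(1 - α) D⁻¹ A`. -/
def pull (N : V → List V) (α : ℝ) (h : V → ℝ) (u : V) : ℝ :=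
  (1 - α) / (N u).length * ((N u).map h).sum

theorem pull_add (N : V → List V) (α : ℝ) (h h' : V → ℝ) :
    pull N α (h + h') = pull N α h + pull N α h' := by
  ext u
  have e : h + h' = fun v => h v + h' v := rfl
  rw [Pi.add_apply, pull, e, List.sum_map_add, mul_add]
  rfl

theorem pull_smul (N : V → List V) (α a : ℝ) (h : V → ℝ) :
    pull N α (a • h) = a • pull N α h := by
  ext u
  have e : a • h = fun v => a * h v := rfl
  rw [Pi.smul_apply, pull, e, List.sum_map_mul_left, pull, smul_eq_mul]
  ring

theorem pull_mono {N : V → List V} {α : ℝ} (hα₁ : α < 1) {h h' : V → ℝ} (hh : h ≤ h') :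
    pull N α h ≤ pull N α h' := fun u =>
  mul_le_mul_of_nonneg_left (List.sum_le_sum fun v _ => hh v)
    (div_nonneg (by linarith) (Nat.cast_nonneg _))

theorem pull_one {N : V → List V} {α : ℝ} (hN : ∀ u, 0 < (N u).length) :
    pull N α 1 = fun _ => 1 - α := by
  ext u
  have h : ((N u).length : ℝ) ≠ 0 := by exact_mod_cast (hN u).ne'
  have e : (1 : V → ℝ) = fun _ => 1 := rfl
  simp [pull, e, h]

variable [DecidableEq V]

/-- The vector that adds `x` at each entry of the list `l`. -/
def listFlow (l : List V) (x : ℝ) : V → ℝ := (l.map fun v => Pi.single v x).sum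

theorem listFlow_cons (v : V) (l : List V) (x : ℝ) :
    listFlow (v :: l) x = Pi.single v x + listFlow l x := by simp [listFlow]

variable [Fintype V]

/-- The expected residues `(1 - α) A D⁻¹ x` after one iteration from `x`. -/
def flow (N : V → List V) (α : ℝ) (x : V → ℝ) : V → ℝ :=
  ∑ u, listFlow (N u) ((1 - α) / (N u).length * x u)

theorem dotProduct_listFlow (h : V → ℝ) (l : List V) (x : ℝ) :
    dotProduct h (listFlow l x) = x * (l.map h).sum := by
  induction l with
  | nil => simp [listFlow]
  | cons v l ih =>
    rw [listFlow_cons, dotProduct_add, ih, dotProduct_single, List.map_cons, List.sum_cons]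
    ring

theorem dotProduct_flow (N : V → List V) (α : ℝ) (h x : V → ℝ) :
    dotProduct h (flow N α x) = dotProduct (pull N α h) x := by
  rw [flow, dotProduct_sum]
  refine Finset.sum_congr rfl fun u _ => ?_
  rw [dotProduct_listFlow, pull]
  ring

theorem flow_eq_sum_nonzeros (N : V → List V) (α : ℝ) (x : V → ℝ) :
    ((nonzeros x).toList.map fun u => listFlow (N u) ((1 - α) / (N u).length * x u)).sum
      = flow N α x := by
  rw [Finset.sum_map_toList, flow]
  refine Finset.sum_subset (Finset.subset_univ _) fun u _ hu => ?_
  have : x u = 0 := by simpa [nonzeros] using hu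
  simp [this, listFlow]

end Operators

section Program

/-! ### The sampling loop as a sequence of coin flips -/

theorem geometricTrials_bind_apply {Ω : Type*} {p : unitInterval} (hp : p ≠ 0) (F : ℕ → PMF Ω)
    (ω : Ω) : ((geometricTrials p).bind F) ω
      = ∑' k : ℕ, ENNReal.ofReal ((1 - p) ^ k * p) * F (k + 1) ω := by
  rw [geometricTrials, PMF.bind_map, PMF.bind_apply]
  refine tsum_congr fun k => ?_
  rw [MeasureTheory.Measure.toPMF_apply, ProbabilityTheory.geometricMeasure_singleton hp]
  rfl

/-- The geometric distribution is memoryless: the first trial succeeds, or the number of trials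
is one more than a fresh geometric number. -/
theorem geometricTrials_bind_apply_succ {Ω : Type*} {p : unitInterval} (hp : p ≠ 0)
    (F : ℕ → PMF Ω) (ω : Ω) : ((geometricTrials p).bind F) ω
      = ENNReal.ofReal p * F 1 ω
        + ENNReal.ofReal (1 - p) * ((geometricTrials p).bind fun k => F (k + 1)) ω := by
  have h1 : (0 : ℝ) ≤ 1 - p := by have := p.2.2; linarith
  rw [geometricTrials_bind_apply hp, geometricTrials_bind_apply hp,
    tsum_eq_zero_add' ENNReal.summable, ← ENNReal.tsum_mul_left]
  congr 1
  · simp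
  · refine tsum_congr fun k => ?_
    rw [← mul_assoc, ← ENNReal.ofReal_mul h1]
    congr 2
    ring

variable {V : Type*}

theorem sampleLoop_of_length_le [DecidableEq V] (nbrs : List V) (θ : ℝ) (p : unitInterval)
    {idx : ℕ} (s : State V) (h : nbrs.length ≤ idx) :
    sampleLoop nbrs θ p idx s = PMF.pure (tick 1 s) := by
  rw [sampleLoop]
  have : ∀ rg, ¬ (0 < rg ∧ idx + rg ≤ nbrs.length) := fun rg => by omega
  simp only [this, dite_false, PMF.bind_const]

/-- Skipping ahead by a geometric number amounts to flipping a coin of bias `p` at each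
neighbour. -/
theorem sampleLoop_apply [DecidableEq V] (nbrs : List V) (θ : ℝ) {p : unitInterval} (hp : p ≠ 0)
    {idx : ℕ} (s : State V) (h : idx < nbrs.length) (ω : State V) :
    sampleLoop nbrs θ p idx s ω
      = ENNReal.ofReal p * sampleLoop nbrs θ p (idx + 1) (push θ (tick 1 s) nbrs[idx]) ω
        + ENNReal.ofReal (1 - p) * sampleLoop nbrs θ p (idx + 1) s ω := by
  rw [sampleLoop, geometricTrials_bind_apply_succ hp]
  congr 2
  · have h1 : 0 < 1 ∧ idx + 1 ≤ nbrs.length := ⟨one_pos, h⟩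
    rw [dif_pos h1]
    rfl
  · conv_rhs => rw [sampleLoop]
    rw [geometricTrials_bind_apply hp, geometricTrials_bind_apply hp]
    refine tsum_congr fun k => ?_
    congr 2
    have e : idx + (k + 1 + 1) = idx + 1 + (k + 1) := by omega
    by_cases hk : idx + 1 + (k + 1) ≤ nbrs.length
    · rw [dif_pos ⟨by omega, by omega⟩, dif_pos ⟨by omega, hk⟩]
      congr 1
      simp only [e]
    · rw [dif_neg (by omega), dif_neg (by omega)]

/-! ### The effect of a part of an iteration on the residues -/

variable [Fintype V]

/-- `s'` may arise from `s` in the course of one iteration: only `r^(ℓ+1)` and the counters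
change, every new nonzero entry of `r^(ℓ+1)` is paid for by a residue update, and apart from `k`
elementary steps there are at most two for each residue update. -/
structure Extends (k : ℕ) (s s' : State V) : Prop where
  res_eq : s'.res = s.res
  acc_eq : s'.acc = s.acc
  next_nonneg : 0 ≤ s.next → 0 ≤ s'.next
  nonzeros_le : (nonzeros s'.next).card + s.pushes ≤ (nonzeros s.next).card + s'.pushes
  steps_le : s'.steps + 2 * s.pushes ≤ s.steps + k + 2 * s'.pushes

theorem Extends.trans {k l : ℕ} {s₁ s₂ s₃ : State V} (h : Extends k s₁ s₂)
    (h' : Extends l s₂ s₃) : Extends (k + l) s₁ s₃ where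
  res_eq := h'.res_eq.trans h.res_eq
  acc_eq := h'.acc_eq.trans h.acc_eq
  next_nonneg := h'.next_nonneg ∘ h.next_nonneg
  nonzeros_le := by have := h.nonzeros_le; have := h'.nonzeros_le; omega
  steps_le := by have := h.steps_le; have := h'.steps_le; omega

theorem Extends.mono {k l : ℕ} {s s' : State V} (h : Extends k s s') (hkl : k ≤ l) :
    Extends l s s' :=
  { h with steps_le := by have := h.steps_le; omega }

theorem extends_tick (k : ℕ) (s : State V) : Extends k s (tick k s) where
  res_eq := rfl
  acc_eq := rfl
  next_nonneg := id
  nonzeros_le := le_rfl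
  steps_le := le_rfl

/-- After an iteration, `∑ β acc + ∑ x res` is a linear functional of the new residues plus the
old value of `∑ β acc`. -/
theorem dotProduct_acc_add_potential {α : ℝ} {β x : V → ℝ} {s s' : State V}
    (h : s'.acc = s.acc + α • s'.res) :
    dotProduct β s'.acc + dotProduct x s'.res
      = dotProduct (α • β + x) s'.res + dotProduct β s.acc := by
  rw [h, dotProduct_add, add_dotProduct, smul_dotProduct, dotProduct_smul]
  ring

/-- A random part `P` of an iteration, started from the state `s`, adds to `r^(ℓ+1)` a random
vector with expected value `w`. Since its increments are independent and at most `θ` where they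
are random at all, every linear functional `h` of it has variance at most `θ ∑ h² w`; since they
are at least `θ`, the expected number of updates is at most `∑ w / θ`. -/
structure IsIncrement (θ : ℝ) (k : ℕ) (w : V → ℝ) (s : State V) (P : PMF (State V)) : Prop where
  finite : P.support.Finite
  ext : ∀ s' ∈ P.support, Extends k s s'
  mean_eq : ∀ h : V → ℝ,
    mean P (fun s' => dotProduct h s'.next) = dotProduct h s.next + dotProduct h w
  sq_le : ∀ (h : V → ℝ) (κ : ℝ), mean P (fun s' => (dotProduct h s'.next + κ) ^ 2) ≤
    (dotProduct h s.next + dotProduct h w + κ) ^ 2 + θ * dotProduct (h ^ 2) w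
  pushes_le : mean P (fun s' => (s'.pushes : ℝ)) ≤ s.pushes + dotProduct 1 w / θ

theorem isIncrement_pure_tick (θ : ℝ) (k : ℕ) (s : State V) :
    IsIncrement θ k 0 s (PMF.pure (tick k s)) where
  finite := by simp
  ext s' hs' := by
    rw [PMF.mem_support_pure_iff] at hs'
    subst hs'
    exact extends_tick k s
  mean_eq h := by simp [mean_pure, tick]
  sq_le h κ := by simp [mean_pure, tick]
  pushes_le := by simp [mean_pure, tick]

theorem IsIncrement.bind {θ : ℝ} {k l : ℕ} {w w' : V → ℝ} {s : State V} {P : PMF (State V)}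
    {Q : State V → PMF (State V)} (hP : IsIncrement θ k w s P)
    (hQ : ∀ s' ∈ P.support, IsIncrement θ l w' s' (Q s')) :
    IsIncrement θ (k + l) (w + w') s (P.bind Q) where
  finite := finite_support_bind hP.finite fun s' hs' => (hQ s' hs').finite
  ext s'' hs'' := by
    obtain ⟨s', hs', h⟩ := (PMF.mem_support_bind_iff _ _ _).mp hs''
    exact (hP.ext s' hs').trans ((hQ s' hs').ext s'' h)
  mean_eq h := by
    rw [mean_bind hP.finite fun s' hs' => (hQ s' hs').finite,
      mean_congr hP.finite fun s' hs' => (hQ s' hs').mean_eq h, mean_add hP.finite, hP.mean_eq,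
      mean_const hP.finite, dotProduct_add, add_assoc]
  sq_le h κ := by
    rw [mean_bind hP.finite fun s' hs' => (hQ s' hs').finite]
    refine (mean_mono hP.finite fun s' hs' => (hQ s' hs').sq_le h κ).trans ?_
    rw [mean_add hP.finite, mean_const hP.finite]
    have h1 := hP.sq_le h (dotProduct h w' + κ)
    simp only [← add_assoc] at h1
    rw [dotProduct_add, dotProduct_add, ← add_assoc]
    linarith
  pushes_le := by
    rw [mean_bind hP.finite fun s' hs' => (hQ s' hs').finite]
    refine (mean_mono hP.finite fun s' hs' => (hQ s' hs').pushes_le).trans ?_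
    rw [mean_add hP.finite, mean_const hP.finite, dotProduct_add, add_div]
    have := hP.pushes_le
    linarith

variable [DecidableEq V]

theorem card_nonzeros_update_le (x : V → ℝ) (v : V) (a : ℝ) :
    (nonzeros (Function.update x v a)).card ≤ (nonzeros x).card + 1 := by
  refine (Finset.card_le_card (t := insert v (nonzeros x)) fun u hu => ?_).trans
    (Finset.card_insert_le _ _)
  by_cases h : u = v
  · simp [h]
  · simpa [nonzeros, h] using hu

/-- One update pays for itself and for one further step. -/
theorem extends_push {x : ℝ} (hx : 0 ≤ x) {k : ℕ} (hk : k ≤ 1) (s : State V) (v : V) :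
    Extends 0 s (push x (tick k s) v) where
  res_eq := rfl
  acc_eq := rfl
  next_nonneg h := by
    intro u
    by_cases huv : u = v
    · subst huv
      simpa [push, tick] using add_nonneg (h u) hx
    · simpa [push, tick, huv] using h u
  nonzeros_le := by
    have := card_nonzeros_update_le s.next v (s.next v + x)
    simp only [push, tick]
    omega
  steps_le := by simp only [push, tick]; omega

theorem dotProduct_push (h : V → ℝ) (x : ℝ) (s : State V) (v : V) :
    dotProduct h (push x s v).next = dotProduct h s.next + x * h v := by
  have : (push x s v).next = s.next + Pi.single v x := by
    ext u
    by_cases huv : u = v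
    · subst huv; simp [push]
    · simp [push, huv]
  rw [this, dotProduct_add, dotProduct_single, mul_comm x]

theorem isIncrement_pure_push {θ x : ℝ} (hθ : 0 < θ) (hx : θ ≤ x) (s : State V) (v : V) :
    IsIncrement θ 0 (Pi.single v x) s (PMF.pure (push x s v)) where
  finite := by simp
  ext s' hs' := by
    rw [PMF.mem_support_pure_iff] at hs'
    subst hs'
    exact extends_push (hθ.le.trans hx) zero_le_one s v
  mean_eq h := by rw [mean_pure, dotProduct_push, dotProduct_single, mul_comm x]
  sq_le h κ := by
    rw [mean_pure, dotProduct_push, dotProduct_single, dotProduct_single, mul_comm x]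
    have : 0 ≤ θ * ((h ^ 2) v * x) :=
      mul_nonneg hθ.le (mul_nonneg (sq_nonneg (h v)) (hθ.le.trans hx))
    linarith
  pushes_le := by
    have : 1 ≤ x / θ := by rwa [one_le_div hθ]
    rw [mean_pure, dotProduct_single, Pi.one_apply, one_mul]
    simp only [push]
    push_cast
    linarith

theorem isIncrement_foldl_push {θ x : ℝ} (hθ : 0 < θ) (hx : θ ≤ x) (l : List V) (s : State V) :
    IsIncrement θ 0 (listFlow l x) s (PMF.pure (l.foldl (push x) s)) := by
  induction l generalizing s with
  | nil => simpa [listFlow, tick] using isIncrement_pure_tick θ 0 s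
  | cons v l ih =>
    rw [List.foldl_cons, listFlow_cons,
      ← PMF.pure_bind (push x s v) fun s' => PMF.pure (l.foldl (push x) s')]
    exact (isIncrement_pure_push hθ hx s v).bind fun s' _ => ih s'

/-- Flipping a coin of bias `p` for an update by `θ` and then going on. -/
theorem isIncrement_of_mixture {θ p : ℝ} (hθ : 0 < θ) (hp₀ : 0 ≤ p) (hp₁ : p ≤ 1) {k : ℕ}
    {w : V → ℝ} {s : State V} {v : V} {P Q R : PMF (State V)}
    (hP : ∀ ω, P ω = ENNReal.ofReal p * Q ω + ENNReal.ofReal (1 - p) * R ω)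
    (hQ : IsIncrement θ k w (push θ (tick 1 s) v) Q) (hR : IsIncrement θ k w s R) :
    IsIncrement θ k (Pi.single v (p * θ) + w) s P := by
  have hp₁' : 0 ≤ 1 - p := by linarith
  have hmean := mean_of_mixture hp₀ hp₁' hP hQ.finite hR.finite
  have htick : (tick 1 s).next = s.next := rfl
  refine ⟨finite_support_of_mixture hP hQ.finite hR.finite, fun s' hs' => ?_, fun h => ?_,
    fun h κ => ?_, ?_⟩
  · by_cases h : s' ∈ Q.support
    · simpa using (extends_push hθ.le le_rfl s v).trans (hQ.ext s' h)
    · refine hR.ext s' fun h' => ?_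
      rw [← PMF.apply_eq_zero_iff] at h
      exact hs' (by rw [hP, h, h']; simp)
  · rw [hmean, hQ.mean_eq, hR.mean_eq, dotProduct_push, htick, dotProduct_add, dotProduct_single]
    ring
  · have h1 := mul_le_mul_of_nonneg_left (hQ.sq_le h κ) hp₀
    have h2 := mul_le_mul_of_nonneg_left (hR.sq_le h κ) hp₁'
    rw [dotProduct_push, htick] at h1
    rw [hmean, dotProduct_add, dotProduct_single, dotProduct_add, dotProduct_single, Pi.pow_apply]
    -- the exact variance of the coin flip is smaller than the bound by this square
    have h3 : 0 ≤ (p * θ * h v) ^ 2 := sq_nonneg _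
    nlinarith
  · have h1 := mul_le_mul_of_nonneg_left hQ.pushes_le hp₀
    have h2 := mul_le_mul_of_nonneg_left hR.pushes_le hp₁'
    rw [hmean, dotProduct_add, dotProduct_single, Pi.one_apply, one_mul, add_div,
      mul_div_cancel_right₀ _ hθ.ne']
    simp only [push, tick] at h1
    push_cast at h1
    linarith

theorem isIncrement_sampleLoop {θ : ℝ} (hθ : 0 < θ) {p : unitInterval} (hp : p ≠ 0)
    (nbrs : List V) (idx : ℕ) (s : State V) :
    IsIncrement θ 1 (listFlow (nbrs.drop idx) (p * θ)) s (sampleLoop nbrs θ p idx s) := by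
  induction hn : nbrs.length - idx generalizing idx s with
  | zero =>
    have h : nbrs.length ≤ idx := by omega
    rw [sampleLoop_of_length_le nbrs θ p s h, List.drop_eq_nil_of_le h]
    exact isIncrement_pure_tick θ 1 s
  | succ n ih =>
    have h : idx < nbrs.length := by omega
    rw [List.drop_eq_getElem_cons h, listFlow_cons]
    exact isIncrement_of_mixture hθ p.2.1 p.2.2 (sampleLoop_apply nbrs θ hp s h)
      (ih (idx + 1) _ (by omega)) (ih (idx + 1) _ (by omega))

theorem isIncrement_processNode {N : V → List V} {α θ : ℝ} (hα₁ : α < 1) (hθ : 0 < θ) {u : V}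
    (hN : 0 < (N u).length) {s : State V} (hu : 0 < s.res u) :
    IsIncrement θ 2 (listFlow (N u) ((1 - α) / (N u).length * s.res u)) s
      (processNode N α θ u s) := by
  have hd : (0 : ℝ) < (N u).length := by exact_mod_cast hN
  have hα : 0 < 1 - α := by linarith
  have h0 := isIncrement_pure_tick θ 1 s
  rw [processNode]
  split_ifs with h
  · have hx : θ ≤ (1 - α) / (N u).length * s.res u := by
      rw [div_mul_eq_mul_div, le_div_iff₀ hd]; exact h
    have h1 := h0.bind (Q := fun s' => PMF.pure
      ((N u).foldl (push ((1 - α) / (N u).length * s.res u)) s'))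
      fun s' _ => isIncrement_foldl_push hθ hx (N u) s'
    rw [PMF.pure_bind, zero_add] at h1
    exact { h1 with ext := fun s' hs' => (h1.ext s' hs').mono one_le_two }
  · rw [not_le] at h
    set q : ℝ := (1 - α) * s.res u / ((N u).length * θ) with hq
    have hq₀ : 0 < q := by positivity
    have hq₁ : q ≤ 1 := by
      rw [hq, div_le_one (by positivity)]; linarith
    -- the projection to the unit interval does nothing
    have hproj : Set.projIcc 0 1 zero_le_one q = ⟨q, hq₀.le, hq₁⟩ :=
      Set.projIcc_of_mem zero_le_one ⟨hq₀.le, hq₁⟩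
    have hne : (⟨q, hq₀.le, hq₁⟩ : unitInterval) ≠ 0 := fun h' =>
      hq₀.ne' (congrArg Subtype.val h')
    have h1 := h0.bind (Q := fun s' => sampleLoop (N u) θ ⟨q, hq₀.le, hq₁⟩ 0 s')
      fun s' _ => isIncrement_sampleLoop hθ hne (N u) 0 s'
    rw [PMF.pure_bind, zero_add, List.drop_zero] at h1
    have hx : q * θ = (1 - α) / (N u).length * s.res u := by
      rw [hq]; field_simp
    rw [hproj, ← hx]
    exact h1

theorem isIncrement_processNodes {N : V → List V} {α θ : ℝ} (hα₁ : α < 1) (hθ : 0 < θ)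
    (hN : ∀ u, 0 < (N u).length) (us : List V) (s : State V) (hu : ∀ u ∈ us, 0 < s.res u) :
    IsIncrement θ (2 * us.length)
      (us.map fun u => listFlow (N u) ((1 - α) / (N u).length * s.res u)).sum s
      (processNodes N α θ us s) := by
  induction us generalizing s with
  | nil => exact isIncrement_pure_tick θ 0 s
  | cons u us ih =>
    have h1 := isIncrement_processNode hα₁ hθ (hN u) (hu u List.mem_cons_self)
    rw [List.map_cons, List.sum_cons, List.length_cons, mul_add, add_comm (2 * us.length)]
    refine h1.bind fun s' hs' => ?_
    have hres := (h1.ext s' hs').res_eq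
    have h2 := ih s' fun v hv => by rw [hres]; exact hu v (List.mem_cons_of_mem _ hv)
    rwa [hres] at h2

/-! ### One iteration, and all iterations -/

/-- The properties of one iteration on which the analysis rests. The last field is the
amortized step count: the potential `steps + |acc| + 3 |res|`, where `|x|` is the number of
nonzero entries, grows by at most two, and seven for each residue update. -/
structure IsRound (N : V → List V) (α θ : ℝ) (s : State V) (P : PMF (State V)) : Prop where
  finite : P.support.Finite
  res_nonneg : ∀ s' ∈ P.support, 0 ≤ s'.res
  acc_eq : ∀ s' ∈ P.support, s'.acc = s.acc + α • s'.res
  mean_eq : ∀ h : V → ℝ,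
    mean P (fun s' => dotProduct h s'.res) = dotProduct (pull N α h) s.res
  sq_le : ∀ (h : V → ℝ) (κ : ℝ), mean P (fun s' => (dotProduct h s'.res + κ) ^ 2) ≤
    (dotProduct (pull N α h) s.res + κ) ^ 2 + θ * dotProduct (pull N α (h ^ 2)) s.res
  pushes_le : mean P (fun s' => (s'.pushes : ℝ)) ≤ s.pushes + dotProduct (pull N α 1) s.res / θ
  steps_le : ∀ s' ∈ P.support,
    s'.steps + (nonzeros s'.acc).card + 3 * (nonzeros s'.res).card + 7 * s.pushes ≤
      s.steps + (nonzeros s.acc).card + 3 * (nonzeros s.res).card + 2 + 7 * s'.pushes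

theorem card_nonzeros_add_smul_le (x y : V → ℝ) (a : ℝ) :
    (nonzeros (x + a • y)).card ≤ (nonzeros x).card + (nonzeros y).card := by
  refine (Finset.card_le_card (t := nonzeros x ∪ nonzeros y) fun u hu => ?_).trans
    (Finset.card_union_le _ _)
  by_contra hn
  simp only [nonzeros, Finset.mem_union, Finset.mem_filter, Finset.mem_univ, true_and, not_or,
    not_not] at hn
  simp [nonzeros, hn.1, hn.2] at hu

theorem isRound_round {N : V → List V} {α θ : ℝ} (hα₁ : α < 1) (hθ : 0 < θ)
    (hN : ∀ u, 0 < (N u).length) {s : State V} (hs : 0 ≤ s.res) :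
    IsRound N α θ s (round N α θ s) := by
  set s₀ : State V := { tick 2 s with next := 0 } with hs₀
  have hres₀ : s₀.res = s.res := rfl
  have hnext₀ : s₀.next = 0 := rfl
  have hpos : ∀ u ∈ (nonzeros s.res).toList, 0 < s₀.res u := by
    intro u hu
    have : s.res u ≠ 0 := by simpa [nonzeros] using hu
    exact lt_of_le_of_ne (hs u) this.symm
  have key := isIncrement_processNodes hα₁ hθ hN _ s₀ hpos
  rw [hres₀, flow_eq_sum_nonzeros, Finset.length_toList] at key
  have hsupp : ∀ s' ∈ (round N α θ s).support,
      ∃ s₁, Extends (2 * (nonzeros s.res).card) s₀ s₁ ∧ s' = finishRound α s₁ := by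
    intro s' hs'
    obtain ⟨s₁, hs₁, rfl⟩ := (PMF.mem_support_map_iff _ _ _).mp hs'
    exact ⟨s₁, key.ext s₁ hs₁, rfl⟩
  refine ⟨finite_support_map key.finite _, ?_, ?_, fun h => ?_, fun h κ => ?_, ?_, ?_⟩
  · intro s' hs'
    obtain ⟨s₁, h, rfl⟩ := hsupp s' hs'
    exact h.next_nonneg le_rfl
  · intro s' hs'
    obtain ⟨s₁, h, rfl⟩ := hsupp s' hs'
    change s₁.acc + α • s₁.next = s.acc + α • s₁.next
    rw [h.acc_eq]; rfl
  · rw [round, mean_map key.finite]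
    have := key.mean_eq h
    rwa [hnext₀, dotProduct_zero, zero_add, dotProduct_flow] at this
  · rw [round, mean_map key.finite]
    have := key.sq_le h κ
    rwa [hnext₀, dotProduct_zero, zero_add, dotProduct_flow, dotProduct_flow] at this
  · rw [round, mean_map key.finite]
    have := key.pushes_le
    rwa [dotProduct_flow] at this
  · intro s' hs'
    obtain ⟨s₁, h, rfl⟩ := hsupp s' hs'
    have h1 := h.nonzeros_le
    have h2 := h.steps_le
    have h3 := card_nonzeros_add_smul_le s₁.acc s₁.next α
    have h4 : (nonzeros s₀.next).card = 0 := by simp [hnext₀, nonzeros]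
    have h5 : s₀.pushes = s.pushes := rfl
    have h6 : s₀.steps = s.steps + 2 := rfl
    have h7 : s₁.acc = s.acc := h.acc_eq
    have h8 : s₁.res = s.res := h.res_eq
    rw [h7] at h3
    simp only [finishRound, h7, h8]
    omega

theorem finite_support_rounds {N : V → List V} {α θ : ℝ} (hα₁ : α < 1) (hθ : 0 < θ)
    (hN : ∀ u, 0 < (N u).length) (k : ℕ) {s : State V} (hs : 0 ≤ s.res) :
    (rounds N α θ k s).support.Finite := by
  induction k generalizing s with
  | zero => simp [rounds]
  | succ k ih =>
    have hr := isRound_round (N := N) hα₁ hθ hN hs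
    exact finite_support_bind hr.finite fun s' hs' => ih (hr.res_nonneg s' hs')

theorem steps_rounds_le {N : V → List V} {α θ : ℝ} (hα₁ : α < 1) (hθ : 0 < θ)
    (hN : ∀ u, 0 < (N u).length) (k : ℕ) {s : State V} (hs : 0 ≤ s.res) :
    ∀ s' ∈ (rounds N α θ k s).support,
      s'.steps + (nonzeros s'.acc).card + 7 * s.pushes ≤
        s.steps + (nonzeros s.acc).card + 3 * (nonzeros s.res).card + 2 * k + 7 * s'.pushes := by
  induction k generalizing s with
  | zero =>
    intro s' hs'
    rw [rounds, PMF.mem_support_pure_iff] at hs'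
    subst hs'
    omega
  | succ k ih =>
    intro s'' hs''
    have hr := isRound_round (N := N) hα₁ hθ hN hs
    obtain ⟨s', hs', h⟩ := (PMF.mem_support_bind_iff _ _ _).mp hs''
    have h1 := ih (hr.res_nonneg s' hs') s'' h
    have h2 := hr.steps_le s' hs'
    omega

/-- Each update moves at least `θ`, and the total residue shrinks by the factor `1 - α` per
iteration, so the expected number of updates is at most the total residue over `α θ`. -/
theorem mean_pushes_rounds_le {N : V → List V} {α θ : ℝ} (hα₀ : 0 < α) (hα₁ : α < 1)
    (hθ : 0 < θ) (hN : ∀ u, 0 < (N u).length) (k : ℕ) {s : State V} (hs : 0 ≤ s.res) :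
    mean (rounds N α θ k s) (fun s' => (s'.pushes : ℝ)) ≤
      s.pushes + 1 / (α * θ) * dotProduct 1 s.res := by
  induction k generalizing s with
  | zero =>
    rw [rounds, mean_pure]
    have : 0 ≤ 1 / (α * θ) * dotProduct 1 s.res :=
      mul_nonneg (by positivity) (dotProduct_nonneg_of_nonneg zero_le_one hs)
    linarith
  | succ k ih =>
    have hr := isRound_round (N := N) hα₁ hθ hN hs
    rw [rounds, mean_bind hr.finite fun s' hs' =>
      finite_support_rounds hα₁ hθ hN k (hr.res_nonneg s' hs')]
    refine (mean_mono hr.finite fun s' hs' => ih (hr.res_nonneg s' hs')).trans ?_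
    rw [mean_add hr.finite, mean_const_mul hr.finite, hr.mean_eq]
    have h1 := hr.pushes_le
    have h2 : dotProduct (pull N α 1) s.res = (1 - α) * dotProduct 1 s.res := by
      rw [pull_one hN]; simp [dotProduct, Finset.mul_sum]
    have h0 : 0 ≤ dotProduct 1 s.res := dotProduct_nonneg_of_nonneg zero_le_one hs
    rw [h2] at h1 ⊢
    have h3 : (1 - α) * dotProduct 1 s.res / θ + 1 / (α * θ) * ((1 - α) * dotProduct 1 s.res)
        = (1 - α ^ 2) * (1 / (α * θ) * dotProduct 1 s.res) := by
      field_simp; ring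
    have h4 : 0 ≤ 1 / (α * θ) * dotProduct 1 s.res := by positivity
    nlinarith [sq_nonneg α]

/-- The expected contribution of a unit of residue at each node to `∑ β acc` over the next `j`
iterations. -/
def potential (N : V → List V) (α : ℝ) (β : V → ℝ) : ℕ → V → ℝ
  | 0 => 0
  | j + 1 => pull N α (α • β + potential N α β j)

/-- The martingale property: `∑ β acc + ∑ potential res` is preserved in expectation. -/
theorem mean_dotProduct_acc_rounds {N : V → List V} {α θ : ℝ} (hα₁ : α < 1) (hθ : 0 < θ)
    (hN : ∀ u, 0 < (N u).length) (β : V → ℝ) (k : ℕ) {s : State V} (hs : 0 ≤ s.res) :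
    mean (rounds N α θ k s) (fun s' => dotProduct β s'.acc)
      = dotProduct β s.acc + dotProduct (potential N α β k) s.res := by
  induction k generalizing s with
  | zero => simp [rounds, mean_pure, potential]
  | succ k ih =>
    have hr := isRound_round (N := N) hα₁ hθ hN hs
    rw [rounds, mean_bind hr.finite fun s' hs' =>
      finite_support_rounds hα₁ hθ hN k (hr.res_nonneg s' hs'),
      mean_congr hr.finite fun s' hs' => (ih (hr.res_nonneg s' hs')).trans
        (dotProduct_acc_add_potential (hr.acc_eq s' hs')),
      mean_add hr.finite, mean_const hr.finite, hr.mean_eq, potential, add_comm]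

/-- If `z` solves `z = (1 - α) D⁻¹ A z + α β` and is at most `b`, then each iteration adds at
most `θ b ∑ z res` to the second moment of the martingale. -/
theorem mean_sq_dotProduct_acc_rounds_le {N : V → List V} {α θ b : ℝ} (hα₀ : 0 < α)
    (hα₁ : α < 1) (hθ : 0 < θ) (hN : ∀ u, 0 < (N u).length) {β z : V → ℝ} (hβ : 0 ≤ β)
    (hz : z = pull N α z + α • β) (hzb : ∀ v, z v ≤ b) (hb : 0 ≤ b)
    (k : ℕ) (hpot : ∀ j, 0 ≤ potential N α β j ∧ α • β + potential N α β j ≤ z)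
    {s : State V} (hs : 0 ≤ s.res) :
    mean (rounds N α θ k s) (fun s' => dotProduct β s'.acc ^ 2) ≤
      (dotProduct β s.acc + dotProduct (potential N α β k) s.res) ^ 2
        + k * (θ * b * dotProduct z s.res) := by
  have hpz : pull N α z ≤ z := by
    intro u
    have := congrFun hz u
    have h2 : 0 ≤ (α • β) u := mul_nonneg hα₀.le (hβ u)
    rw [Pi.add_apply] at this
    linarith
  induction k generalizing s with
  | zero => simp [rounds, mean_pure, potential]
  | succ k ih =>
    have hr := isRound_round (N := N) hα₁ hθ hN hs
    rw [rounds, mean_bind hr.finite fun s' hs' =>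
      finite_support_rounds hα₁ hθ hN k (hr.res_nonneg s' hs')]
    have hstep : ∀ s' ∈ (round N α θ s).support,
        mean (rounds N α θ k s') (fun s'' => dotProduct β s''.acc ^ 2) ≤
          (dotProduct (α • β + potential N α β k) s'.res + dotProduct β s.acc) ^ 2
            + k * θ * b * dotProduct z s'.res := fun s' hs' => by
      rw [← dotProduct_acc_add_potential (hr.acc_eq s' hs')]
      exact (ih (hr.res_nonneg s' hs')).trans (le_of_eq (by ring))
    refine (mean_mono hr.finite hstep).trans ?_
    rw [mean_add hr.finite, mean_const_mul hr.finite, hr.mean_eq]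
    have h1 := hr.sq_le (α • β + potential N α β k) (dotProduct β s.acc)
    have h2 : dotProduct (pull N α z) s.res ≤ dotProduct z s.res :=
      dotProduct_le_dotProduct_of_nonneg_right hpz hs
    have h3 : dotProduct (pull N α ((α • β + potential N α β k) ^ 2)) s.res
        ≤ b * dotProduct z s.res := by
      have h4 : (α • β + potential N α β k) ^ 2 ≤ b • z := by
        intro v
        have h5 := (hpot k).2 v
        have h6 : 0 ≤ (α • β + potential N α β k) v :=
          add_nonneg (mul_nonneg hα₀.le (hβ v)) ((hpot k).1 v)
        have h7 := hzb v
        simp only [Pi.pow_apply, Pi.smul_apply, smul_eq_mul]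
        nlinarith
      have h8 : pull N α ((α • β + potential N α β k) ^ 2) ≤ b • z := by
        refine (pull_mono hα₁ h4).trans ?_
        rw [pull_smul]
        exact smul_le_smul_of_nonneg_left hpz hb
      rw [← smul_eq_mul, ← smul_dotProduct]
      exact dotProduct_le_dotProduct_of_nonneg_right h8 hs
    have h9 := mul_le_mul_of_nonneg_left h3 hθ.le
    have h10 : k * θ * b * dotProduct (pull N α z) s.res ≤ k * θ * b * dotProduct z s.res :=
      mul_le_mul_of_nonneg_left h2 (by positivity)
    rw [potential, add_comm (dotProduct β s.acc)]
    push_cast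
    linarith

end Program

/-! ### Bounds on the potential -/

section Potential

variable {V : Type*} {N : V → List V} {α : ℝ}

theorem pull_const (hN : ∀ u, 0 < (N u).length) (a : ℝ) :
    pull N α (fun _ => a) = fun _ => (1 - α) * a := by
  have e : (fun _ => a : V → ℝ) = a • 1 := by ext; simp
  rw [e, pull_smul, pull_one hN]
  ext
  simp [mul_comm]

theorem pull_nonneg (hα₁ : α < 1) {h : V → ℝ} (hh : 0 ≤ h) : 0 ≤ pull N α h := by
  have h1 : pull N α 0 = 0 := by simpa using pull_smul N α 0 0
  rw [← h1]
  exact pull_mono hα₁ hh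

/-- The minimum principle: a supersolution is nonnegative, since its minimum `a` satisfies
`(1 - α) a ≤ a`. -/
theorem nonneg_of_pull_le [Finite V] (hα₀ : 0 < α) (hα₁ : α < 1) (hN : ∀ u, 0 < (N u).length)
    {y : V → ℝ} (hy : pull N α y ≤ y) : 0 ≤ y := by
  intro v
  have : Nonempty V := ⟨v⟩
  obtain ⟨u, hu⟩ := Finite.exists_min y
  have h1 := pull_mono (N := N) hα₁ (h := fun _ => y u) hu u
  rw [pull_const hN] at h1
  have h2 := h1.trans (hy u)
  have h3 : 0 ≤ y u := by
    by_contra hneg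
    nlinarith
  exact h3.trans (hu v)

/-- The maximum principle, the minimum principle for `a - y`. -/
theorem le_of_eq_pull_add [Finite V] (hα₀ : 0 < α) (hα₁ : α < 1)
    (hN : ∀ u, 0 < (N u).length) {y f : V → ℝ} {a : ℝ} (hy : y = pull N α y + f)
    (hf : ∀ v, f v ≤ α * a) (v : V) : y v ≤ a := by
  have key : 0 ≤ (fun _ => a) + (-1 : ℝ) • y := by
    refine nonneg_of_pull_le hα₀ hα₁ hN fun u => ?_
    have h1 := congrFun hy u
    have h2 := hf u
    rw [pull_add, pull_const hN, pull_smul]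
    simp only [Pi.add_apply, Pi.smul_apply, smul_eq_mul] at h1 ⊢
    linarith
  have := key v
  simp only [Pi.zero_apply, Pi.add_apply, Pi.smul_apply, smul_eq_mul] at this
  linarith

/-- The potential converges geometrically, from below, to the limit `z - α β`. -/
theorem potential_bounds (hα₀ : 0 < α) (hα₁ : α < 1) (hN : ∀ u, 0 < (N u).length)
    {β z : V → ℝ} {b : ℝ} (hβ : 0 ≤ β) (hz : z = pull N α z + α • β) (hz₀ : 0 ≤ z)
    (hzb : ∀ v, z v ≤ b) (j : ℕ) :
    0 ≤ potential N α β j ∧ α • β + potential N α β j ≤ z ∧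
      ∀ v, z v - (α • β + potential N α β j) v ≤ (1 - α) ^ (j + 1) * b := by
  have hαβ : 0 ≤ α • β := smul_nonneg hα₀.le hβ
  have hpb : ∀ {x : V → ℝ} {a : ℝ}, (∀ v, x v ≤ a) → ∀ v, pull N α x v ≤ (1 - α) * a := by
    intro x a hx v
    have := pull_mono (N := N) hα₁ (h' := fun _ => a) hx v
    rwa [pull_const hN] at this
  induction j with
  | zero =>
    refine ⟨le_rfl, fun v => ?_, fun v => ?_⟩
    · have h1 := congrFun hz v
      have h2 := pull_nonneg (N := N) hα₁ hz₀ v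
      simp only [potential, Pi.add_apply, Pi.zero_apply, add_zero] at h1 h2 ⊢
      linarith
    · have h1 := congrFun hz v
      have h2 := hpb hzb v
      simp only [potential, Pi.add_apply, Pi.zero_apply, add_zero, zero_add, pow_one] at h1 h2 ⊢
      linarith
  | succ j ih =>
    obtain ⟨ih₀, ih₁, ih₂⟩ := ih
    refine ⟨pull_nonneg hα₁ (add_nonneg hαβ ih₀), fun v => ?_, fun v => ?_⟩
    · have h1 := congrFun hz v
      have h2 := pull_mono (N := N) hα₁ ih₁ v
      simp only [potential, Pi.add_apply] at h1 h2 ⊢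
      linarith
    · have h1 := congrFun hz v
      have h2 := hpb (x := z + (-1 : ℝ) • (α • β + potential N α β j))
        (a := (1 - α) ^ (j + 1) * b) (fun u => by
          have := ih₂ u
          rw [Pi.add_apply, Pi.smul_apply, smul_eq_mul]
          linarith) v
      rw [pull_add, pull_smul, Pi.add_apply, Pi.smul_apply, smul_eq_mul] at h2
      rw [Pi.add_apply] at h1 ⊢
      rw [potential, pow_succ' (1 - α) (j + 1), mul_assoc]
      linarith

end Potential

/-! ### PageRank on a graph without isolated vertices -/

section PageRank

variable {V : Type*} [Fintype V] {G : SimpleGraph V} [DecidableRel G.Adj]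

theorem card_edgeFinset_pos {t : V} (ht : 0 < G.degree t) : 0 < G.edgeFinset.card := by
  obtain ⟨v, hv⟩ := (G.degree_pos_iff_exists_adj t).mp ht
  exact Finset.card_pos.mpr ⟨s(t, v), by simpa using hv⟩

/-- By the Cauchy–Schwarz inequality, since the degrees of the neighbours of `t` add up to at
most `2 m`. -/
theorem sq_degree_div_le_sum_inv_degree (hdeg : ∀ u, 0 < G.degree u) (t : V) :
    (G.degree t : ℝ) ^ 2 / (2 * G.edgeFinset.card)
      ≤ ∑ u ∈ G.neighborFinset t, 1 / (G.degree u : ℝ) := by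
  have hpos : ∀ u ∈ G.neighborFinset t, (0 : ℝ) < G.degree u := fun u _ => by
    exact_mod_cast hdeg u
  have h1 := Finset.sq_sum_div_le_sum_sq_div (G.neighborFinset t) (fun _ => (1 : ℝ)) hpos
  simp only [Finset.sum_const, G.card_neighborFinset_eq_degree, nsmul_eq_mul, mul_one,
    one_pow] at h1
  refine le_trans ?_ h1
  have hne : (G.neighborFinset t).Nonempty := by
    rw [← Finset.card_pos, G.card_neighborFinset_eq_degree]; exact hdeg t
  have h2 : ∑ u ∈ G.neighborFinset t, (G.degree u : ℝ) ≤ 2 * G.edgeFinset.card := by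
    have := G.sum_degrees_eq_twice_card_edges
    have h3 : ∑ u, (G.degree u : ℝ) = 2 * G.edgeFinset.card := by exact_mod_cast this
    rw [← h3]
    exact Finset.sum_le_sum_of_subset_of_nonneg (Finset.subset_univ _) fun _ _ _ => by positivity
  have h4 := Finset.sum_pos hpos hne
  gcongr

variable [DecidableEq V] {N : V → List V} {α : ℝ}

theorem IsAdjacencyLists.toFinset_eq (hN : IsAdjacencyLists G N) (u : V) :
    (N u).toFinset = G.neighborFinset u := by
  ext v; simp [(hN u).2]

theorem IsAdjacencyLists.length_eq (hN : IsAdjacencyLists G N) (u : V) :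
    (N u).length = G.degree u := by
  rw [← List.toFinset_card_of_nodup (hN u).1, hN.toFinset_eq, G.card_neighborFinset_eq_degree]

theorem IsAdjacencyLists.sum_map (hN : IsAdjacencyLists G N) (h : V → ℝ) (u : V) :
    ((N u).map h).sum = ∑ v ∈ G.neighborFinset u, h v := by
  rw [← hN.toFinset_eq, List.sum_toFinset h (hN u).1]

theorem pageRank_eq (hα₀ : 0 < α) (hα₁ : α < 1) (hdeg : ∀ u, 0 < G.degree u) (v : V) :
    pageRank G α v = (1 - α) * ∑ u ∈ G.neighborFinset v, pageRank G α u / G.degree u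
      + α / Fintype.card V := by
  have h := (isPageRank_iff G hα₀ hα₁ hdeg _).mpr rfl
  have h1 := congrFun h v
  rw [Pi.add_apply, Pi.smul_apply, smul_eq_mul] at h1
  rw [h1]
  congr 2
  rw [Matrix.mulVec, dotProduct, ← Finset.sum_subset (Finset.subset_univ (G.neighborFinset v))]
  · refine Finset.sum_congr rfl fun u hu => ?_
    have : G.Adj v u := by simpa using hu
    simp [transition, Matrix.mul_diagonal, this, div_eq_mul_inv, mul_comm]
  · intro u _ hu
    have : ¬ G.Adj v u := by simpa using hu
    simp [transition, Matrix.mul_diagonal, this]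

/-- As the graph is undirected, `π / d` is a fixed point of the transposed walk. -/
theorem pageRank_div_degree_eq (hα₀ : 0 < α) (hα₁ : α < 1) (hN : IsAdjacencyLists G N)
    (hdeg : ∀ u, 0 < G.degree u) (a : ℝ) :
    (fun v => a * (pageRank G α v / G.degree v))
      = pull N α (fun v => a * (pageRank G α v / G.degree v))
        + α • fun v => a / (Fintype.card V * G.degree v) := by
  ext v
  have h := pageRank_eq hα₀ hα₁ hdeg v
  have hd : (G.degree v : ℝ) ≠ 0 := by exact_mod_cast (hdeg v).ne'
  have hn : (Fintype.card V : ℝ) ≠ 0 := by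
    exact_mod_cast (Fintype.card_pos_iff.mpr ⟨v⟩).ne'
  rw [Pi.add_apply, Pi.smul_apply, pull, hN.sum_map, hN.length_eq, ← Finset.mul_sum, smul_eq_mul]
  rw [h]
  field_simp

theorem pageRank_div_degree_nonneg (hα₀ : 0 < α) (hα₁ : α < 1) (hN : IsAdjacencyLists G N)
    (hdeg : ∀ u, 0 < G.degree u) (v : V) : 0 ≤ pageRank G α v / G.degree v := by
  have h := pageRank_div_degree_eq hα₀ hα₁ hN hdeg 1
  simp only [one_mul] at h
  have hN' : ∀ u, 0 < (N u).length := fun u => by rw [hN.length_eq]; exact hdeg u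
  refine nonneg_of_pull_le (y := fun v => pageRank G α v / G.degree v) hα₀ hα₁ hN' (fun u => ?_) v
  have h1 := congrFun h u
  rw [Pi.add_apply, Pi.smul_apply, smul_eq_mul] at h1
  have h2 : 0 ≤ α * (1 / ((Fintype.card V : ℝ) * G.degree u)) := by positivity
  linarith

/-- `n π ≤ d`, because `d` is a supersolution of the equation for `n π`. -/
theorem pageRank_div_degree_le (hα₀ : 0 < α) (hα₁ : α < 1) (hN : IsAdjacencyLists G N)
    (hdeg : ∀ u, 0 < G.degree u) (v : V) :
    pageRank G α v / G.degree v ≤ 1 / Fintype.card V := by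
  have h := pageRank_div_degree_eq hα₀ hα₁ hN hdeg 1
  simp only [one_mul] at h
  have hN' : ∀ u, 0 < (N u).length := fun u => by rw [hN.length_eq]; exact hdeg u
  refine le_of_eq_pull_add (y := fun v => pageRank G α v / G.degree v) hα₀ hα₁ hN' h
    (fun u => ?_) v
  rw [Pi.smul_apply, smul_eq_mul]
  have hn : (0 : ℝ) < Fintype.card V := by exact_mod_cast Fintype.card_pos_iff.mpr ⟨v⟩
  have hd : (1 : ℝ) ≤ G.degree u := by exact_mod_cast hdeg u
  gcongr
  nlinarith

theorem le_pageRank (hα₀ : 0 < α) (hα₁ : α < 1) (hN : IsAdjacencyLists G N)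
    (hdeg : ∀ u, 0 < G.degree u) (v : V) : α / Fintype.card V ≤ pageRank G α v := by
  rw [pageRank_eq hα₀ hα₁ hdeg v]
  have : 0 ≤ ∑ u ∈ G.neighborFinset v, pageRank G α u / G.degree u :=
    Finset.sum_nonneg fun u _ => pageRank_div_degree_nonneg hα₀ hα₁ hN hdeg u
  have := mul_nonneg (sub_nonneg.mpr hα₁.le) this
  linarith

/-- The walks of length zero and one alone contribute `1 / d + (1 - α) d / (2 m)` to
`n π(t) / (α d)`; the bound follows by the inequality of arithmetic and geometric means. -/
theorem sqrt_le_pageRank_div_degree (hα₀ : 0 < α) (hα₁ : α < 1) (hN : IsAdjacencyLists G N)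
    (hdeg : ∀ u, 0 < G.degree u) (t : V) :
    α * Real.sqrt (2 * (1 - α) / G.edgeFinset.card)
      ≤ Fintype.card V * pageRank G α t / G.degree t := by
  have hn : (0 : ℝ) < Fintype.card V := by exact_mod_cast Fintype.card_pos_iff.mpr ⟨t⟩
  have hd : (0 : ℝ) < G.degree t := by exact_mod_cast hdeg t
  have hα' : 0 < 1 - α := by linarith
  set m : ℝ := (G.edgeFinset.card : ℝ) with hm
  have hm₀ : 0 < m := Nat.cast_pos.mpr (card_edgeFinset_pos (hdeg t))
  have h1 : α / Fintype.card V * (1 + (1 - α) * ((G.degree t : ℝ) ^ 2 / (2 * m)))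
      ≤ pageRank G α t := by
    rw [pageRank_eq hα₀ hα₁ hdeg t]
    -- each neighbour `u` has `π(u) ≥ α / n`
    have h2 : α / Fintype.card V * ((G.degree t : ℝ) ^ 2 / (2 * m))
        ≤ ∑ u ∈ G.neighborFinset t, pageRank G α u / G.degree u := by
      refine (mul_le_mul_of_nonneg_left (sq_degree_div_le_sum_inv_degree hdeg t)
        (by positivity)).trans ?_
      rw [Finset.mul_sum]
      refine Finset.sum_le_sum fun u _ => ?_
      rw [mul_one_div]
      have := le_pageRank hα₀ hα₁ hN hdeg u
      gcongr
    have h3 := mul_le_mul_of_nonneg_left h2 hα'.le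
    linarith
  have h2 : α * (1 / G.degree t + (1 - α) * G.degree t / (2 * m))
      ≤ Fintype.card V * pageRank G α t / G.degree t := by
    rw [le_div_iff₀ hd]
    refine le_trans (le_of_eq ?_) (mul_le_mul_of_nonneg_left h1 hn.le)
    field_simp
  refine le_trans (mul_le_mul_of_nonneg_left ?_ hα₀.le) h2
  refine Real.sqrt_le_iff.mpr ⟨by positivity, ?_⟩
  -- `4 x y ≤ (x + y)²`
  have h3 : 2 * (1 - α) / m = 4 * (1 / G.degree t) * ((1 - α) * G.degree t / (2 * m)) := by
    field_simp; ring
  rw [h3]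
  nlinarith [sq_nonneg (1 / (G.degree t : ℝ) - (1 - α) * G.degree t / (2 * m))]

end PageRank

/-! ### The parameters -/

section Parameters

variable {α c : ℝ} {n m d : ℕ}

theorem truncLength_pos (hα₀ : 0 < α) (hα₁ : α < 1) (hc : 0 < c) (hcα : c * α < 2 * n) :
    0 < truncLength α c n := by
  have hn : (0 : ℝ) < 2 * n := (mul_pos hc hα₀).trans hcα
  exact Real.logb_pos_of_base_lt_one (by linarith) (by linarith) (by positivity)
    ((div_lt_one hn).mpr hcα)

/-- This is what the truncation length is chosen for. -/
theorem pow_floor_truncLength_le (hα₀ : 0 < α) (hα₁ : α < 1) (hc : 0 < c)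
    (hcα : c * α < 2 * n) :
    (1 - α) ^ (⌊truncLength α c n⌋₊ + 1) ≤ c * α / (2 * n) := by
  have hα : 0 < 1 - α := by linarith
  have hn : (0 : ℝ) < 2 * n := (mul_pos hc hα₀).trans hcα
  have h : (0 : ℝ) < c * α / (2 * n) := by positivity
  rw [← Real.rpow_natCast]
  calc (1 - α) ^ ((⌊truncLength α c n⌋₊ + 1 : ℕ) : ℝ)
      ≤ (1 - α) ^ truncLength α c n :=
        Real.rpow_le_rpow_of_exponent_ge hα (by linarith)
          (by push_cast; exact (Nat.lt_floor_add_one _).le)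
    _ = c * α / (2 * n) := Real.rpow_logb hα (by linarith) h

theorem threshold_eq (hα₀ : 0 < α) (hα₁ : α < 1) (hc : 0 < c) (hcα : c * α < 2 * n) :
    threshold α c n m d = α * c ^ 2 / (12 * truncLength α c n)
      * max (1 / (d : ℝ)) (Real.sqrt (2 * (1 - α) / m)) := by
  have hL := truncLength_pos hα₀ hα₁ hc hcα
  rw [threshold, mul_max_of_nonneg _ _ (by positivity)]
  congr 1
  rw [mul_one_div, div_div]

theorem sqrt_div_eq_inv (α : ℝ) (m : ℕ) :
    Real.sqrt (m / (2 * (1 - α))) = (Real.sqrt (2 * (1 - α) / m))⁻¹ := by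
  rw [← Real.sqrt_inv, inv_div]

/-- The explicit bound on the cost is `1 / (α θ)`. -/
theorem one_div_mul_threshold (hα₀ : 0 < α) (hα₁ : α < 1) (hc : 0 < c) (hcα : c * α < 2 * n)
    (hd : 0 < d) (hm : 0 < m) :
    1 / (α * threshold α c n m d) = 12 * truncLength α c n / (α ^ 2 * c ^ 2)
      * min (d : ℝ) (Real.sqrt (m / (2 * (1 - α)))) := by
  have hL := truncLength_pos hα₀ hα₁ hc hcα
  have hα : 0 < 1 - α := by linarith
  have hd' : (0 : ℝ) < d := by exact_mod_cast hd
  have hm' : (0 : ℝ) < m := by exact_mod_cast hm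
  have hs : 0 < Real.sqrt (2 * (1 - α) / m) := Real.sqrt_pos.mpr (by positivity)
  have hmin : min (d : ℝ) (Real.sqrt (m / (2 * (1 - α))))
      = 1 / max (1 / (d : ℝ)) (Real.sqrt (2 * (1 - α) / m)) := by
    rw [sqrt_div_eq_inv]
    rcases le_total (1 / (d : ℝ)) (Real.sqrt (2 * (1 - α) / m)) with h | h
    · rw [max_eq_right h, min_eq_right, one_div]
      rw [inv_le_comm₀ hs hd', ← one_div]; exact h
    · rw [max_eq_left h, min_eq_left, one_div_one_div]
      rw [le_inv_comm₀ hd' hs, ← one_div]; exact h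
  have hM : 0 < max (1 / (d : ℝ)) (Real.sqrt (2 * (1 - α) / m)) := lt_max_of_lt_right hs
  rw [threshold_eq hα₀ hα₁ hc hcα, hmin]
  field_simp

/-- For constant `α` and `c`, the explicit bounds are `O(log n · min {d, √m})`. -/
theorem exists_log_bound (hα₀ : 0 < α) (hα₁ : α < 1) (hc : 0 < c) :
    ∃ C : ℝ, 0 < C ∧ ∀ n m d : ℕ, 2 ≤ n → 1 ≤ m → 1 ≤ d → c * α < 2 * n →
      12 * truncLength α c n / (α ^ 2 * c ^ 2) * min (d : ℝ) (Real.sqrt (m / (2 * (1 - α)))) ≤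
          C * Real.log n * min (d : ℝ) (Real.sqrt m) ∧
      8 * (1 + truncLength α c n + 12 * truncLength α c n / (α ^ 2 * c ^ 2)
          * min (d : ℝ) (Real.sqrt (m / (2 * (1 - α))))) ≤
        C * Real.log n * min (d : ℝ) (Real.sqrt m) := by
  have hα : 0 < 1 - α := by linarith
  have hlogα : 0 < -Real.log (1 - α) := by
    have := Real.log_neg hα (by linarith); linarith
  have hlog2 : 0 < Real.log 2 := Real.log_pos one_lt_two
  set A : ℝ := (1 + |Real.log (2 / (c * α))| / Real.log 2) / -Real.log (1 - α) with hA
  have hA₀ : 0 ≤ A := by positivity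
  set D : ℝ := max 1 (Real.sqrt (1 / (2 * (1 - α)))) with hD
  have hD₁ : 1 ≤ D := le_max_left _ _
  set F : ℝ := 12 * A / (α ^ 2 * c ^ 2) * D with hF
  have hF₀ : 0 ≤ F := by positivity
  refine ⟨8 * (1 / Real.log 2 + A + F), by positivity, fun n m d hn hm hd hcα => ?_⟩
  have hn' : (2 : ℝ) ≤ n := by exact_mod_cast hn
  have hd' : (1 : ℝ) ≤ d := by exact_mod_cast hd
  have hm' : (1 : ℝ) ≤ m := by exact_mod_cast hm
  have hlogn : Real.log 2 ≤ Real.log n := Real.log_le_log two_pos hn'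
  have hL₀ := (truncLength_pos hα₀ hα₁ hc hcα).le
  have hL : truncLength α c n ≤ A * Real.log n := by
    have e : truncLength α c n = (Real.log n + Real.log (2 / (c * α))) / -Real.log (1 - α) := by
      rw [truncLength, Real.logb, ← Real.log_mul (by positivity) (by positivity), div_neg,
        ← neg_div, ← Real.log_inv]
      congr 2
      field_simp
    rw [e, hA, div_mul_eq_mul_div]
    gcongr
    have h1 : |Real.log (2 / (c * α))|
        ≤ |Real.log (2 / (c * α))| / Real.log 2 * Real.log n := by
      rw [div_mul_eq_mul_div, le_div_iff₀ hlog2]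
      gcongr
    have h2 := le_abs_self (Real.log (2 / (c * α)))
    linarith
  set M : ℝ := min (d : ℝ) (Real.sqrt m) with hM
  have hM₁ : 1 ≤ M := le_min hd' (Real.one_le_sqrt.mpr hm')
  have hmin : min (d : ℝ) (Real.sqrt (m / (2 * (1 - α)))) ≤ D * M := by
    rw [hM, mul_min_of_nonneg _ _ (by linarith)]
    refine min_le_min ?_ ?_
    · nlinarith
    · rw [div_eq_mul_one_div (m : ℝ), Real.sqrt_mul (by linarith), mul_comm]
      gcongr
      exact le_max_right _ _
  have hB : 12 * truncLength α c n / (α ^ 2 * c ^ 2)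
      * min (d : ℝ) (Real.sqrt (m / (2 * (1 - α)))) ≤ F * Real.log n * M := by
    calc _ ≤ 12 * (A * Real.log n) / (α ^ 2 * c ^ 2) * (D * M) := by gcongr
      _ = F * Real.log n * M := by rw [hF]; ring
  have h1 : 1 ≤ 1 / Real.log 2 * Real.log n * M := by
    have : 1 ≤ 1 / Real.log 2 * Real.log n := by
      rwa [one_div_mul_eq_div, one_le_div hlog2]
    nlinarith
  have hlogn₀ : 0 < Real.log n := hlog2.trans_le hlogn
  have h2 : truncLength α c n ≤ A * Real.log n * M :=
    hL.trans (le_mul_of_one_le_right (by positivity) hM₁)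
  have h3 : 0 ≤ F * Real.log n * M := by positivity
  constructor
  · nlinarith
  · nlinarith

end Parameters

/-! ### The guarantees of the algorithm -/

section Guarantees

variable {V : Type*} [Fintype V] [DecidableEq V] {G : SimpleGraph V} [DecidableRel G.Adj]
  {N : V → List V} {α c θ : ℝ}

theorem initState_res_nonneg {V : Type*} [DecidableEq V] (α : ℝ) (t : V) : 0 ≤ (initState α t).res :=
  Pi.single_nonneg.mpr zero_le_one

theorem finite_support_setPush (hα₁ : α < 1) (hθ : 0 < θ) (hN : ∀ u, 0 < (N u).length) (c : ℝ)
    (t : V) : (setPush N α c θ t).support.Finite :=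
  finite_support_map (finite_support_rounds hα₁ hθ hN _ (initState_res_nonneg α t)) _

theorem mean_pushes_setPush_le (hα₀ : 0 < α) (hα₁ : α < 1) (hθ : 0 < θ)
    (hN : ∀ u, 0 < (N u).length) (c : ℝ) (t : V) :
    mean (setPush N α c θ t) (fun o => (o.pushes : ℝ)) ≤ 1 / (α * θ) := by
  have hs := initState_res_nonneg α t
  rw [setPush, mean_map (finite_support_rounds hα₁ hθ hN _ hs)]
  refine (mean_pushes_rounds_le hα₀ hα₁ hθ hN _ hs).trans ?_
  simp [initState]

theorem card_nonzeros_single_le (t : V) (a : ℝ) : (nonzeros (Pi.single t a : V → ℝ)).card ≤ 1 := by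
  refine Finset.card_le_one.mpr fun u hu v hv => ?_
  have h : ∀ w ∈ nonzeros (Pi.single t a : V → ℝ), w = t := by
    intro w hw
    by_contra hne
    simp [nonzeros, hne] at hw
  rw [h u hu, h v hv]

theorem mean_steps_setPush_le (hα₁ : α < 1) (hθ : 0 < θ) (hN : ∀ u, 0 < (N u).length) (c : ℝ)
    (t : V) : mean (setPush N α c θ t) (fun o => (o.steps : ℝ)) ≤
      8 + 2 * (⌊truncLength α c (Fintype.card V)⌋₊ : ℝ)
        + 7 * mean (setPush N α c θ t) (fun o => (o.pushes : ℝ)) := by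
  have hs := initState_res_nonneg α t
  have hfin := finite_support_rounds hα₁ hθ hN ⌊truncLength α c (Fintype.card V)⌋₊ hs
  rw [setPush, mean_map hfin, mean_map hfin, ← mean_const_mul hfin]
  conv_rhs =>
    enter [1]
    rw [← mean_const hfin (8 + 2 * (⌊truncLength α c (Fintype.card V)⌋₊ : ℝ))]
  rw [← mean_add hfin]
  refine mean_mono hfin fun s hsupp => ?_
  have h := steps_rounds_le hα₁ hθ hN _ hs s hsupp
  have h1 : (nonzeros (initState α t).res).card ≤ 1 := card_nonzeros_single_le t 1
  have h2 : (nonzeros (initState α t).acc).card ≤ 1 := card_nonzeros_single_le t α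
  have h3 : (initState α t).steps = 3 := rfl
  have h4 : (initState α t).pushes = 0 := rfl
  have : (output N t s).steps ≤ 8 + 2 * ⌊truncLength α c (Fintype.card V)⌋₊
      + 7 * (output N t s).pushes := by
    simp only [output]
    omega
  exact_mod_cast this

/-- The estimate is the random variable `∑ β acc` with `β = d_t / (n d)`. Its mean misses `π(t)`
by at most `(1 - α) ^ (L + 1) ≤ c π(t) / 2`, and its variance is at most
`L θ (d_t / n) π(t) ≤ c² π(t)² / 12`. -/
theorem isApproximation_setPush (hα₀ : 0 < α) (hα₁ : α < 1) (hc : 0 < c)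
    (hN : IsAdjacencyLists G N) (hdeg : ∀ u, 0 < G.degree u) (t : V)
    (hcα : c * α < 2 * (Fintype.card V : ℕ))
    (hθ : θ = threshold α c (Fintype.card V) G.edgeFinset.card (G.degree t)) :
    IsApproximation ((setPush N α c θ t).map Output.estimate) c (1 / 3) (pageRank G α t) := by
  have hN' : ∀ u, 0 < (N u).length := fun u => by rw [hN.length_eq]; exact hdeg u
  set n : ℕ := Fintype.card V with hn
  set L : ℝ := truncLength α c n with hL
  set K : ℕ := ⌊L⌋₊ with hK
  set x : ℝ := pageRank G α t with hx
  have hn₀ : (0 : ℝ) < n := by exact_mod_cast Fintype.card_pos_iff.mpr ⟨t⟩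
  have hd₀ : (0 : ℝ) < G.degree t := by exact_mod_cast hdeg t
  have hL₀ : 0 < L := truncLength_pos hα₀ hα₁ hc hcα
  have hx₁ : α / n ≤ x := le_pageRank hα₀ hα₁ hN hdeg t
  have hx₀ : 0 < x := lt_of_lt_of_le (by positivity) hx₁
  rw [threshold_eq hα₀ hα₁ hc hcα, ← hL] at hθ
  set μ : ℝ := max (1 / (G.degree t : ℝ)) (Real.sqrt (2 * (1 - α) / G.edgeFinset.card)) with hμ
  have hμ₀ : 0 < μ := lt_max_of_lt_left (by positivity)
  have hθ₀ : 0 < θ := by rw [hθ]; positivity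
  -- the two terms of the threshold correspond to the two lower bounds on `π(t)`
  have hμx : α * μ * (G.degree t / n) ≤ x := by
    have h1 : α * μ ≤ n * x / G.degree t := by
      rw [hμ, mul_max_of_nonneg _ _ hα₀.le]
      refine max_le ?_ (sqrt_le_pageRank_div_degree hα₀ hα₁ hN hdeg t)
      rw [mul_one_div]
      gcongr
      rwa [div_le_iff₀' hn₀] at hx₁
    calc α * μ * (G.degree t / n) ≤ n * x / G.degree t * (G.degree t / n) := by gcongr
      _ = x := by field_simp
  set β : V → ℝ := fun v => G.degree t / (n * G.degree v) with hβ
  set z : V → ℝ := fun v => G.degree t * (pageRank G α v / G.degree v) with hz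
  set b : ℝ := G.degree t / n with hb
  have hβ₀ : 0 ≤ β := fun v => by simp only [hβ]; positivity
  have hz₀ : 0 ≤ z := fun v =>
    mul_nonneg hd₀.le (pageRank_div_degree_nonneg hα₀ hα₁ hN hdeg v)
  have hzb : ∀ v, z v ≤ b := fun v => by
    have h := mul_le_mul_of_nonneg_left (pageRank_div_degree_le hα₀ hα₁ hN hdeg v) hd₀.le
    rwa [mul_one_div] at h
  have hb₁ : b ≤ 1 := by
    rw [hb, div_le_one hn₀]
    exact_mod_cast (G.degree_lt_card_verts t).le
  have hzeq : z = pull N α z + α • β := pageRank_div_degree_eq hα₀ hα₁ hN hdeg _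
  have hzt : z t = x := by simp only [hz]; field_simp; rfl
  have hβt : β t = 1 / n := by simp only [hβ]; field_simp
  have hpot := potential_bounds hα₀ hα₁ hN' hβ₀ hzeq hz₀ hzb
  have hs := initState_res_nonneg α t
  have hfin := finite_support_rounds hα₁ hθ₀ hN' K hs
  have hacc : dotProduct β (initState α t).acc = α / n := by
    simp only [initState, dotProduct_single, hβt]; ring
  have hres : ∀ h : V → ℝ, dotProduct h (initState α t).res = h t := fun h => by
    simp [initState]
  set a : ℝ := α / n + potential N α β K t with ha
  have hmean := mean_dotProduct_acc_rounds hα₁ hθ₀ hN' β K hs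
  have hsq := mean_sq_dotProduct_acc_rounds_le hα₀ hα₁ hθ₀ hN' hβ₀ hzeq hzb (by positivity) K
    (fun j => ⟨(hpot j).1, (hpot j).2.1⟩) hs
  rw [hacc, hres, ← ha] at hmean
  rw [hacc, hres, hres, ← ha, hzt] at hsq
  have hbias₀ : a ≤ x := by
    have := (hpot K).2.1 t
    simp only [Pi.add_apply, Pi.smul_apply, smul_eq_mul, hβt, mul_one_div, hzt] at this
    exact this
  have hbias : x - a ≤ c * x / 2 := by
    have h1 := (hpot K).2.2 t
    simp only [Pi.add_apply, Pi.smul_apply, smul_eq_mul, hβt, mul_one_div, hzt] at h1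
    have h2 : (1 - α) ^ (K + 1) * b ≤ c * α / (2 * n) := by
      refine (mul_le_of_le_one_right (pow_nonneg (by linarith) _) hb₁).trans ?_
      exact pow_floor_truncLength_le hα₀ hα₁ hc hcα
    have h3 : c * α / (2 * n) = c * (α / n) / 2 := by field_simp
    have h4 : c * (α / n) / 2 ≤ c * x / 2 := by gcongr
    linarith
  have hvar : K * (θ * b * x) ≤ c ^ 2 * x ^ 2 / 12 := by
    have hKL : (K : ℝ) ≤ L := Nat.floor_le hL₀.le
    calc K * (θ * b * x) ≤ L * (θ * b * x) := by gcongr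
      _ = c ^ 2 * (α * μ * b) * x / 12 := by rw [hθ]; field_simp
      _ ≤ c ^ 2 * x * x / 12 := by gcongr
      _ = c ^ 2 * x ^ 2 / 12 := by ring
  have hε : 0 < c * x / 2 := by positivity
  have hcheb := chebyshev hfin _ hε hmean hsq
  rw [IsApproximation, setPush, PMF.map_comp, PMF.toOuterMeasure_map_apply]
  refine le_trans (ENNReal.ofReal_le_ofReal ?_) (hcheb.trans (MeasureTheory.measure_mono fun s hs => ?_))
  · have : K * (θ * b * x) / (c * x / 2) ^ 2 ≤ 1 / 3 := by
      rw [div_le_iff₀ (by positivity)]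
      refine hvar.trans (le_of_eq ?_)
      ring
    linarith
  · have hest : (Output.estimate ∘ output N t) s = dotProduct β s.acc := by
      simp only [Function.comp_apply, output, hN.length_eq, dotProduct, Finset.mul_sum]
      refine Finset.sum_congr rfl fun v _ => ?_
      rw [← hn, hβ]
      have : (G.degree v : ℝ) ≠ 0 := by exact_mod_cast (hdeg v).ne'
      field_simp
    rw [Set.mem_preimage, Set.mem_ofPred_eq, hest]
    have h1 : |dotProduct β s.acc - a| ≤ c * x / 2 := hs
    rw [abs_le] at h1 ⊢
    constructor <;> linarith [h1.1, h1.2]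

end Guarantees

end SetPush

end

/-- `n`, `m` and `d` are the number of nodes, the number of edges and the degree of the target. -/
theorem mainTheorem1 (α c : ℝ) (hα₀ : 0 < α) (hα₁ : α < 1) (hc : 0 < c) :
    ∃ C : ℝ, 0 < C ∧
      ∀ (V : Type*) [Fintype V] [DecidableEq V] (G : SimpleGraph V) [DecidableRel G.Adj]
        (N : V → List V) (t : V) (n m d : ℕ) (L θ : ℝ),
        SetPush.IsAdjacencyLists G N →
        (∀ u, 0 < G.degree u) →
        n = Fintype.card V → m = G.edgeFinset.card → d = G.degree t →
        c * α < 2 * n →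
        L = SetPush.truncLength α c n →
        θ = SetPush.threshold α c n m d →
        -- the estimate has relative error at most `c` with probability at least `2 / 3`
        SetPush.IsApproximation
          ((SetPush.setPush N α c θ t).map SetPush.Output.estimate) c (1 / 3)
          (SetPush.pageRank G α t) ∧
        -- the expected cost, counted in residue updates, with the explicit constant
        SetPush.expectedCount (SetPush.setPush N α c θ t) SetPush.Output.pushes ≤
          ENNReal.ofReal
            (12 * L / (α ^ 2 * c ^ 2) * min (d : ℝ) (Real.sqrt (m / (2 * (1 - α))))) ∧
        -- the explicit bound is `Õ(min {d, √m})`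
        12 * L / (α ^ 2 * c ^ 2) * min (d : ℝ) (Real.sqrt (m / (2 * (1 - α)))) ≤
          C * Real.log n * min (d : ℝ) (Real.sqrt m) ∧
        -- the expected number of all elementary steps, with an absolute constant
        SetPush.expectedCount (SetPush.setPush N α c θ t) SetPush.Output.steps ≤
          ENNReal.ofReal (8 * (1 + L +
            12 * L / (α ^ 2 * c ^ 2) * min (d : ℝ) (Real.sqrt (m / (2 * (1 - α)))))) ∧
        -- the expected number of all elementary steps is `Õ(min {d, √m})`
        SetPush.expectedCount (SetPush.setPush N α c θ t) SetPush.Output.steps ≤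
          ENNReal.ofReal (C * Real.log n * min (d : ℝ) (Real.sqrt m)) ∧
        -- the lower bound on PageRank
        α * Real.sqrt (2 * (1 - α) / m) ≤ n * SetPush.pageRank G α t / d := by
  obtain ⟨C, hC, hbound⟩ := SetPush.exists_log_bound hα₀ hα₁ hc
  refine ⟨C, hC, ?_⟩
  intro V _ _ G _ N t n m d L θ hN hdeg hn hm hd hcα hL hθ
  subst hn hm hd hL
  have hN' : ∀ u, 0 < (N u).length := fun u => by rw [hN.length_eq]; exact hdeg u
  have hm₀ := SetPush.card_edgeFinset_pos (hdeg t)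
  have hn₂ : 2 ≤ Fintype.card V :=
    (Nat.succ_le_succ (hdeg t)).trans (G.degree_lt_card_verts t)
  have hα : 0 < 1 - α := by linarith
  have hL₀ := SetPush.truncLength_pos hα₀ hα₁ hc hcα
  have hB := SetPush.one_div_mul_threshold hα₀ hα₁ hc hcα (hdeg t) hm₀
  rw [← hθ] at hB
  have hθ₀ : 0 < θ := by
    have hd₀ : (0 : ℝ) < G.degree t := by exact_mod_cast hdeg t
    rw [hθ]
    exact lt_max_of_lt_left (by positivity)
  have hfin := SetPush.finite_support_setPush hα₁ hθ₀ hN' c t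
  have hpushes := SetPush.mean_pushes_setPush_le hα₀ hα₁ hθ₀ hN' c t
  have hsteps := SetPush.mean_steps_setPush_le hα₁ hθ₀ hN' c t
  have hfloor := Nat.floor_le hL₀.le
  obtain ⟨hlog₁, hlog₂⟩ := hbound _ _ _ hn₂ hm₀ (hdeg t) hcα
  rw [hB] at hpushes
  rw [SetPush.expectedCount_eq_ofReal_mean hfin, SetPush.expectedCount_eq_ofReal_mean hfin]
  refine ⟨SetPush.isApproximation_setPush hα₀ hα₁ hc hN hdeg t hcα hθ,
    ENNReal.ofReal_le_ofReal hpushes, hlog₁, ENNReal.ofReal_le_ofReal ?_,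
    ENNReal.ofReal_le_ofReal (le_trans ?_ hlog₂),
    SetPush.sqrt_le_pageRank_div_degree hα₀ hα₁ hN hdeg t⟩
  all_goals
    have hB₀ : 0 ≤ 1 / (α * θ) := by positivity
    rw [hB] at hB₀
    linarith
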